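/- Let $X$ be a complex Banach space, $T$ a bounded linear operator on $X$, and let $\sigma_*$ be one of the spectrum $\sigma$, the Browder spectrum $\sigma_b(T)=\{\lambda\in\mathbb C: T-\lambda I \text{ is not a Fredholm operator of finite ascent and descent}\}$, or the Drazin spectrum $\sigma_d(T)=\{\lambda\in\mathbb C: T-\lambda I\text{ is not Drazin invertible}\}$, where $T$ is Drazin invertible if there are a bounded operator $R$ and $n\ge 0$ with $TR=RT$, $RTR=R$ and $T^{n+1}R=T^n$. For $A\subset\mathbb C$ let $\mathrm{acc}\,A$ be the set of accumulation points of $A$, and define the Cantor--Bendixson derivatives by $\mathrm{acc}^0A=A$, $\mathrm{acc}^{\beta+1}A=\mathrm{acc}(\mathrm{acc}^{\beta}A)$, and $\mathrm{acc}^{\alpha}A=\bigcap_{\beta<\alpha}\mathrm{acc}^{\beta}A$ for limit ordinals $\alpha$. Call a bounded operator $T$ on a complex Banach space $X$ $g^{\alpha}_{\sigma_*}$-invertible if - $\alpha=0$ and $0\notin\sigma_*(T)$; or - $\alpha=\beta+1$ is a successor ordinal and there are closed $T$-invariant subspaces $M,N$ with $X=M\oplus N$ such that the restriction $T_M$ is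 invertible and $\mathrm{acc}^{\beta}\,\sigma_*(T_N)\subset\{0\}$; or - $\alpha$ is a limit ordinal and $T$ is $g^{\beta}_{\sigma_*}$-invertible for some successor ordinal $\beta<\alpha$. Then for every ordinal $\alpha$: 1. $T$ is $g^{\alpha}_{\sigma_*}$-invertible if and only if its dual adjoint $T^*$, acting on the dual space $X^*$, is $g^{\alpha}_{\sigma_*}$-invertible. 2. If $S$ is a bounded operator on a complex Banach space $Y$, then $S\oplus T$ is $g^{\alpha}_{\sigma_*}$-invertible if and only if both $S$ and $T$ are $g^{\alpha}_{\sigma_*}$-invertible. 3. $T$ is $g^{\alpha}_{\sigma_*}$-invertible if and only if $T^m$ is $g^{\alpha}_{\sigma_*}$-invertible for some integer $m\ge1$; equivalently, if and only if $T^m$ is $g^{\alpha}_{\sigma_*}$-invertible for every integer $m\ge1$. -/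

import Mathlib

universe u v w

noncomputable section

namespace GInv

/-- The transfinite Cantor-Bendixson derivative `acc^α A` of a set of complex numbers:
`acc^0 A = A`, `acc^(α+1) A = acc (acc^α A)`, and `acc^α A = ⋂ β < α, acc^β A` at limits, where
`acc B` (Mathlib's `derivedSet B`) is the set of all accumulation points of `B` in `ℂ`.
Ordinals of every universe are allowed. -/
def accIter (A : Set ℂ) (α : Ordinal.{w}) : Set ℂ :=
  Ordinal.limitRecOn (motive := fun _ => Set ℂ) α A
    (fun _ B => derivedSet B)
    (fun α _ B => ⋂ (β : Ordinal.{w}) (h : β < α), B β h)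

section Operators

variable {X : Type u} [NormedAddCommGroup X] [NormedSpace ℂ X]

/-- `T` has finite ascent: the chain of kernels of the powers of `T` becomes stationary. -/
def HasFiniteAscent (T : X →L[ℂ] X) : Prop :=
  ∃ n : ℕ, (T ^ n).ker = (T ^ (n + 1)).ker

/-- `T` has finite descent: the chain of ranges of the powers of `T` becomes stationary. -/
def HasFiniteDescent (T : X →L[ℂ] X) : Prop :=
  ∃ n : ℕ, (T ^ n).range = (T ^ (n + 1)).range

/-- `T` is a Browder operator: a Fredholm operator of finite ascent and finite descent. -/
def IsBrowder (T : X →L[ℂ] X) : Prop :=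
  T.IsFredholm ∧ HasFiniteAscent T ∧ HasFiniteDescent T

/-- `T` is Drazin invertible: there is a bounded operator `S` (the Drazin inverse) with
`T S = S T`, `S T S = S` and `T ^ (n + 1) S = T ^ n` for some `n`. -/
def IsDrazinInvertible (T : X →L[ℂ] X) : Prop :=
  ∃ S : X →L[ℂ] X, Commute T S ∧ S * T * S = S ∧ ∃ n : ℕ, T ^ (n + 1) * S = T ^ n

end Operators

/-- The three spectra `σ`, `σ_b`, `σ_d` over which `σ_*` ranges. -/
inductive SpectrumKind
  | full
  | browder
  | drazin

/-- `σ_*(T)`: the spectrum `σ(T)`, the Browder spectrum `σ_b(T)` or the Drazin spectrum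
`σ_d(T)`. -/
def sigmaStar (s : SpectrumKind) {X : Type u} [NormedAddCommGroup X] [NormedSpace ℂ X]
    (T : X →L[ℂ] X) : Set ℂ :=
  match s with
  | .full => spectrum ℂ T
  | .browder => {z : ℂ | ¬ IsBrowder (T - z • (1 : X →L[ℂ] X))}
  | .drazin => {z : ℂ | ¬ IsDrazinInvertible (T - z • (1 : X →L[ℂ] X))}

section GInvertible

variable {X : Type u} [NormedAddCommGroup X] [NormedSpace ℂ X]

/-- `(M, N) ∈ Red(T)`: `M` and `N` are closed `T`-invariant subspaces and `X = M ⊕ N`. -/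
structure IsRed (T : X →L[ℂ] X) (M N : Submodule ℂ X) : Prop where
  isClosed_left : IsClosed (M : Set X)
  isClosed_right : IsClosed (N : Set X)
  invariant_left : ∀ x ∈ M, T x ∈ M
  invariant_right : ∀ x ∈ N, T x ∈ N
  isCompl : IsCompl M N

/-- The condition at the successor ordinal `β + 1`: for some `(M, N) ∈ Red(T)` the restriction
`T_M` is invertible and `acc^β σ_*(T_N) ⊆ {0}`. -/
def IsGInvertibleSucc (s : SpectrumKind) (β : Ordinal.{w}) (T : X →L[ℂ] X) : Prop :=
  ∃ (M N : Submodule ℂ X) (h : IsRed T M N),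
    IsUnit (T.restrict h.invariant_left) ∧
      accIter (sigmaStar s (T.restrict h.invariant_right)) β ⊆ {0}

/-- `T` is `g^α_{σ_*}`-invertible:
* `α = 0`: `0 ∉ σ_*(T)`;
* `α = β + 1`: there is `(M, N) ∈ Red(T)` with `T_M` invertible and `acc^β σ_*(T_N) ⊆ {0}`;
* `α` a limit: `T` is `g^(β + 1)_{σ_*}`-invertible for some ordinal `β` with `β + 1 < α`. -/
def IsGInvertible (s : SpectrumKind) (α : Ordinal.{w}) (T : X →L[ℂ] X) : Prop :=
  Ordinal.limitRecOn (motive := fun _ => Prop) α ((0 : ℂ) ∉ sigmaStar s T)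
    (fun β _ => IsGInvertibleSucc s β T)
    (fun α _ _ => ∃ β : Ordinal.{w}, β + 1 < α ∧ IsGInvertibleSucc s β T)

/-- The dual adjoint `T* : X* → X*`, `f ↦ f ∘ T`, on the space of continuous linear functionals
on `X`. -/
def dualAdjoint (T : X →L[ℂ] X) : StrongDual ℂ X →L[ℂ] StrongDual ℂ X :=
  ContinuousLinearMap.precomp ℂ T

end GInvertible

end GInv

end

/-! Everything rests on one characterization (`isGInvertible_iff`): `T` is `g^α`-invertible exactly
when `0 ∉ acc^α σ_*(T)`. The claims then concern sets: `σ_*(T*) = σ_*(T)`, `σ_*(S ⊕ T) = σ_*(S) ∪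
σ_*(T)`, `σ_*(T^m) = σ_*(T)^m` pointwise, and `acc^α` commutes with finite unions of closed sets and
with the image of a compact set under `z ↦ z^m`.

For the characterization at `β + 1`, suppose `0 ∉ acc^(β+1) σ_*(T)`. Some disc about `0` meets
`acc^β σ_*(T)` at most in `0`. Points of `σ(T)` outside `σ_*(T)` are isolated in `σ(T)`, and a
closed set loses only countably many points on passing to a derivative, so the disc contains
countably many spectral points. Hence a smaller circle about `0` misses `σ(T)`, and its Riesz
idempotent splits off an invertible part from a part `T_N` with spectrum inside the disc; as
`σ_*(T_N) ⊆ σ_*(T)`, `acc^β σ_*(T_N) ⊆ {0}`.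

The three spectra are handled together: `z ∉ σ_*(T)` iff `T - z` has a commuting inverse up to a
residue killed by a power of `T - z` and lying in an ideal, which is zero, the finite-rank
operators, or everything (`RegularMod`, `mem_sigmaStar_iff`). Spectral mapping is then Bézout's
identity. For duals, regularity of `T*` forces `0` to be at most isolated in `σ(T*) = σ(T)`; the
adjoint of the Riesz idempotent of `T` at `0` falls into the ideal on `X*`, and this descends to
`X`. -/

open Filter Topology Set

namespace GInv

/-! ### Cantor–Bendixson derivatives: unions, countable losses, images under powers -/

section CantorBendixson

lemma accIter_zero (A : Set ℂ) : accIter A (0 : Ordinal.{w}) = A :=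
  Ordinal.limitRecOn_zero ..

lemma accIter_add_one (A : Set ℂ) (β : Ordinal.{w}) :
    accIter A (β + 1) = derivedSet (accIter A β) :=
  Ordinal.limitRecOn_add_one ..

lemma accIter_limit (A : Set ℂ) {α : Ordinal.{w}} (hα : Order.IsSuccLimit α) :
    accIter A α = ⋂ (β : Ordinal.{w}) (_ : β < α), accIter A β :=
  Ordinal.limitRecOn_limit _ _ _ _ hα

lemma accIter_mono {A B : Set ℂ} (h : A ⊆ B) (α : Ordinal.{w}) :
    accIter A α ⊆ accIter B α := by
  induction α using Ordinal.limitRecOn with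
  | zero => simpa only [accIter_zero]
  | add_one β ih =>
    rw [accIter_add_one, accIter_add_one]
    exact derivedSet_mono _ _ ih
  | limit α hα ih =>
    rw [accIter_limit A hα, accIter_limit B hα]
    exact iInter₂_mono ih

lemma isClosed_accIter {A : Set ℂ} (hA : IsClosed A) (α : Ordinal.{w}) :
    IsClosed (accIter A α) := by
  induction α using Ordinal.limitRecOn with
  | zero => rwa [accIter_zero]
  | add_one β ih => rw [accIter_add_one]; exact isClosed_derivedSet _
  | limit α hα ih => rw [accIter_limit A hα]; exact isClosed_biInter ih

lemma accIter_antitone {A : Set ℂ} (hA : IsClosed A) :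
    Antitone (fun α : Ordinal.{w} => accIter A α) := by
  intro β α h
  dsimp only
  induction α using Ordinal.limitRecOn with
  | zero => rw [nonpos_iff_eq_zero.1 h]
  | add_one γ ih =>
    rcases h.lt_or_eq with h | rfl
    · rw [accIter_add_one]
      exact ((isClosed_iff_derivedSet_subset _).1 (isClosed_accIter hA γ)).trans
        (ih (Order.lt_add_one_iff.1 h))
    · rfl
  | limit α hα ih =>
    rcases h.lt_or_eq with h | rfl
    · rw [accIter_limit A hα]
      exact biInter_subset_of_mem (t := fun β => accIter A β) h
    · rfl

lemma accIter_subset {A : Set ℂ} (hA : IsClosed A) (α : Ordinal.{w}) : accIter A α ⊆ A := by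
  simpa only [accIter_zero] using accIter_antitone hA (zero_le : 0 ≤ α)

/-- Closedness matters only at limits: a point that leaves one family at stage `β` and the other at
stage `γ` has left both at `max β γ`, because derivatives of closed sets decrease. -/
lemma accIter_union {A B : Set ℂ} (hA : IsClosed A) (hB : IsClosed B) (α : Ordinal.{w}) :
    accIter (A ∪ B) α = accIter A α ∪ accIter B α := by
  induction α using Ordinal.limitRecOn with
  | zero => simp only [accIter_zero]
  | add_one β ih => simp only [accIter_add_one, ih, derivedSet_union]
  | limit α hα ih =>
    refine Subset.antisymm (fun x hx => ?_) (union_subset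
      (accIter_mono subset_union_left α) (accIter_mono subset_union_right α))
    rw [accIter_limit _ hα] at hx
    simp only [mem_iInter] at hx
    by_contra h
    simp only [mem_union, not_or, accIter_limit _ hα, mem_iInter, not_forall] at h
    obtain ⟨⟨β, hβ, hxβ⟩, γ, hγ, hxγ⟩ := h
    have := hx (max β γ) (max_lt hβ hγ)
    rw [ih _ (max_lt hβ hγ)] at this
    rcases this with h | h
    · exact hxβ (accIter_antitone hA (le_max_left β γ) h)
    · exact hxγ (accIter_antitone hB (le_max_right β γ) h)

lemma subset_accIter_of_preperfect {D : Set ℂ} (hD : Preperfect D) (α : Ordinal.{w}) :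
    D ⊆ accIter D α := by
  induction α using Ordinal.limitRecOn with
  | zero => rw [accIter_zero]
  | add_one β ih =>
    rw [accIter_add_one]
    exact (preperfect_iff_subset_derivedSet.1 hD).trans (derivedSet_mono _ _ ih)
  | limit α hα ih =>
    rw [accIter_limit _ hα]
    exact subset_iInter₂ ih

/-- By the Cantor–Bendixson theorem a closed set is a countable set together with a perfect one, and
the perfect part survives every derivative. -/
lemma countable_diff_accIter {A : Set ℂ} (hA : IsClosed A) (α : Ordinal.{w}) :
    (A \ accIter A α).Countable := by
  obtain ⟨V, D, hV, hD, h⟩ := exists_countable_union_perfect_of_isClosed hA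
  refine hV.mono fun x ⟨hx, hxα⟩ => ?_
  rw [h] at hx
  refine hx.resolve_right fun hxD => hxα ?_
  exact accIter_mono (h ▸ subset_union_right) α (subset_accIter_of_preperfect hD.acc α hxD)

/-- Compactness gives one inclusion, finiteness of the fibres of `z ↦ z ^ m` the other. -/
lemma derivedSet_image_pow {A : Set ℂ} (hA : IsCompact A) {m : ℕ} (hm : m ≠ 0) :
    derivedSet ((fun z => z ^ m) '' A) = (fun z => z ^ m) '' derivedSet A := by
  have hfin : ∀ w : ℂ, {z : ℂ | z ^ m = w}.Finite := fun w => by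
    refine (Multiset.finite_toSet (Polynomial.nthRoots m w)).subset fun z hz => ?_
    simpa [Polynomial.mem_nthRoots (Nat.pos_of_ne_zero hm)] using hz
  ext w
  constructor
  · intro hw
    by_contra hcon
    -- If no preimage of `w` is an accumulation point of `A`, then near each point of `A` the only
    -- image value close to `w` is `w` itself; compactness makes this uniform over `A`.
    have key : ∀ z ∈ A, ∃ t ∈ 𝓝[A] z, ∃ U ∈ 𝓝 w, ∀ y ∈ t, y ^ m ∈ U → y ^ m = w := by
      intro z hz
      by_cases hzw : z ^ m = w
      · have hacc : ¬ AccPt z (𝓟 A) := fun h => hcon ⟨z, h, hzw⟩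
        rw [accPt_iff_frequently] at hacc
        simp only [not_frequently, not_and] at hacc
        refine ⟨_, inter_mem_nhdsWithin A hacc, univ, univ_mem, fun y ⟨hyA, hy⟩ _ => ?_⟩
        by_cases hyz : y = z
        · rwa [hyz]
        · exact absurd hyA (hy hyz)
      · obtain ⟨U, V, hU, hV, hzU, hwV, hd⟩ := t2_separation hzw
        refine ⟨_, mem_nhdsWithin_of_mem_nhds
          ((continuous_pow m).continuousAt.preimage_mem_nhds (hU.mem_nhds hzU)), V,
          hV.mem_nhds hwV, fun y hy hyV => ?_⟩
        exact absurd hyV (disjoint_left.1 hd hy)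
    have : ∃ U ∈ 𝓝 w, ∀ y ∈ A, y ^ m ∈ U → y ^ m = w := by
      refine hA.induction_on (p := fun t => ∃ U ∈ 𝓝 w, ∀ y ∈ t, y ^ m ∈ U → y ^ m = w)
        ⟨univ, univ_mem, by simp⟩ ?_ ?_ key
      · rintro s t hst ⟨U, hU, h⟩
        exact ⟨U, hU, fun y hy => h y (hst hy)⟩
      · rintro s t ⟨U, hU, h⟩ ⟨V, hV, h'⟩
        refine ⟨U ∩ V, inter_mem hU hV, ?_⟩
        rintro y (hy | hy) hyUV
        exacts [h y hy hyUV.1, h' y hy hyUV.2]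
    obtain ⟨U, hU, h⟩ := this
    obtain ⟨_, ⟨hyU, y, hyA, rfl⟩, hyw⟩ := accPt_iff_nhds.1 hw U hU
    exact hyw (h y hyA hyU)
  · rintro ⟨z, hz, rfl⟩
    rw [mem_derivedSet, accPt_iff_frequently] at hz ⊢
    have hev : ∀ᶠ y in 𝓝 z, y ≠ z → y ^ m ≠ z ^ m := by
      have h1 : ({y : ℂ | y ^ m = z ^ m} \ {z})ᶜ ∈ 𝓝 z :=
        ((hfin (z ^ m)).sdiff).isClosed.isOpen_compl.mem_nhds (by simp)
      filter_upwards [h1] with y hy hyz h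
      exact hy ⟨h, hyz⟩
    have hc : Tendsto (fun y : ℂ => y ^ m) (𝓝 z) (𝓝 (z ^ m)) := (continuous_pow m).continuousAt
    exact hc.frequently ((hz.and_eventually hev).mono fun y ⟨⟨hyz, hy⟩, h⟩ =>
      ⟨h hyz, y, hy, rfl⟩)

lemma accIter_image_pow {A : Set ℂ} (hA : IsCompact A) {m : ℕ} (hm : m ≠ 0)
    (α : Ordinal.{w}) :
    accIter ((fun z => z ^ m) '' A) α = (fun z => z ^ m) '' accIter A α := by
  induction α using Ordinal.limitRecOn with
  | zero => simp only [accIter_zero]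
  | add_one β ih =>
    rw [accIter_add_one, accIter_add_one, ih, derivedSet_image_pow
      (hA.of_isClosed_subset (isClosed_accIter hA.isClosed β) (accIter_subset hA.isClosed β)) hm]
  | limit α hα ih =>
    ext w
    have hfin : {z : ℂ | z ^ m = w}.Finite := by
      refine (Multiset.finite_toSet (Polynomial.nthRoots m w)).subset fun z hz => ?_
      simpa [Polynomial.mem_nthRoots (Nat.pos_of_ne_zero hm)] using hz
    rw [accIter_limit _ hα, accIter_limit _ hα]
    constructor
    · intro hw
      simp only [mem_iInter] at hw
      by_contra hcon
      have h1 : ∀ z : ℂ, z ^ m = w → ∃ β < α, z ∉ accIter A β := by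
        intro z hz
        by_contra! h
        exact hcon ⟨z, mem_iInter₂.2 h, hz⟩
      choose! f hf hfA using h1
      -- Each of the finitely many `m`-th roots of `w` leaves the derivatives at some stage below
      -- `α`; by the last of these stages all have left.
      obtain ⟨γ, hγα, hγ⟩ : ∃ γ < α, ∀ z ∈ hfin.toFinset, f z ≤ γ := by
        refine ⟨hfin.toFinset.sup f, (Finset.sup_lt_iff ?_).2 fun z hz => hf z (by simpa using hz),
          fun z hz => Finset.le_sup hz⟩
        exact bot_lt_iff_ne_bot.2 hα.ne_bot
      have := hw γ hγα
      rw [ih γ hγα] at this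
      obtain ⟨z, hz, hzw⟩ := this
      exact hfA z hzw (accIter_antitone hA.isClosed (hγ z (by simpa using hzw)) hz)
    · rintro ⟨z, hz, rfl⟩
      simp only [mem_iInter] at hz ⊢
      intro β hβ
      rw [ih β hβ]
      exact ⟨z, hz β hβ, rfl⟩

end CantorBendixson

/-! ### Drazin-type inverses modulo an ideal -/

section Ring

variable {R : Type*} [Ring R]

/-- `a` has a commuting inverse up to a residue `1 - a * b` which lies in `J` and is annihilated
by a power of `a`. -/
def RegularMod (J : TwoSidedIdeal R) (a : R) : Prop :=
  ∃ b, Commute a b ∧ (∃ n, a ^ n * (1 - a * b) = 0) ∧ 1 - a * b ∈ J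

lemma pow_mul_eq_zero_of_le {a e : R} {n m : ℕ} (h : a ^ n * e = 0) (hnm : n ≤ m) :
    a ^ m * e = 0 := by
  rw [← Nat.sub_add_cancel hnm, pow_add, mul_assoc, h, mul_zero]

/-- The Drazin inverse lies in the bicommutant. -/
lemma commute_drazinInverse {a b c : R} (hab : Commute a b) (hb : b * a * b = b) {n : ℕ}
    (hn : a ^ n * (1 - a * b) = 0) (hac : Commute a c) : Commute b c := by
  set p := a * b with hp
  have hba : b * a = p := hab.eq.symm
  have hpp : p * p = p := by rw [hp, mul_assoc, ← mul_assoc b, hb]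
  have hpk : ∀ k : ℕ, 1 ≤ k → a ^ k * b ^ k = p := by
    intro k hk
    induction k, hk using Nat.le_induction with
    | base => simp [hp]
    | succ k hk ih =>
      rw [← hab.mul_pow, pow_succ, hab.mul_pow, ih, ← hp, hpp]
  -- The exponent `n + 1` also ensures `p = a ^ (n + 1) * b ^ (n + 1)`, which fails in general for
  -- exponent `0`. Moving `a ^ (n + 1)` across `c` then kills both off-diagonal corners of `c`.
  have hN : a ^ (n + 1) * (1 - p) = 0 := pow_mul_eq_zero_of_le hn n.le_succ
  have hcp : Commute a (1 - p) :=
    (Commute.one_right a).sub_right ((Commute.refl a).mul_right hab)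
  have hN' : (1 - p) * a ^ (n + 1) = 0 := by rw [← (hcp.pow_left (n + 1)).eq, hN]
  have hk := hpk (n + 1) (by lia)
  have hk' : b ^ (n + 1) * a ^ (n + 1) = p := by rw [← (hab.pow_pow _ _).eq, hk]
  have h1 : (1 - p) * c * p = 0 := by
    calc (1 - p) * c * p = (1 - p) * (c * a ^ (n + 1)) * b ^ (n + 1) := by
          rw [← hk]; simp only [mul_assoc]
      _ = ((1 - p) * a ^ (n + 1)) * c * b ^ (n + 1) := by
          rw [← (hac.pow_left (n + 1)).eq]; simp only [mul_assoc]
      _ = 0 := by rw [hN', zero_mul, zero_mul]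
  have h2 : p * c * (1 - p) = 0 := by
    calc p * c * (1 - p) = b ^ (n + 1) * (a ^ (n + 1) * c) * (1 - p) := by
          rw [← hk']; simp only [mul_assoc]
      _ = b ^ (n + 1) * c * (a ^ (n + 1) * (1 - p)) := by
          rw [(hac.pow_left (n + 1)).eq]; simp only [mul_assoc]
      _ = 0 := by rw [hN, mul_zero]
  have hpc : p * c = c * p := by
    have e1 : c * p = p * c * p := by
      rw [sub_mul, sub_mul, one_mul] at h1; exact sub_eq_zero.1 h1
    have e2 : p * c = p * c * p := by
      rw [mul_sub, mul_one] at h2; exact sub_eq_zero.1 h2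
    rw [e2, ← e1]
  have hbp : b * p = b := by rw [hp, ← mul_assoc, hb]
  have hpb : p * b = b := by rw [← hba, hb]
  calc b * c = b * p * c := by rw [hbp]
    _ = b * (c * a) * b := by rw [mul_assoc b, hpc, hp]; simp only [mul_assoc]
    _ = p * c * b := by rw [← hac.eq, ← mul_assoc, hba]
    _ = c * b := by rw [hpc, mul_assoc, hpb]

variable {J : TwoSidedIdeal R} {a b : R}

/-- The commuting inverse of `RegularMod` can be taken to be a Drazin inverse. -/
lemma RegularMod.exists_drazinInverse (h : RegularMod J a) :
    ∃ b, Commute a b ∧ b * a * b = b ∧ (∃ n, a ^ n * (1 - a * b) = 0) ∧ 1 - a * b ∈ J ∧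
      ∀ c, Commute a c → Commute b c := by
  obtain ⟨b, hab, ⟨n, hn⟩, hJ⟩ := h
  have hcp : Commute a (1 - a * b) :=
    (Commute.one_right a).sub_right ((Commute.refl a).mul_right hab)
  have hk : ∀ k, a ^ n * (a * b) ^ k = a ^ n := by
    intro k
    induction k with
    | zero => simp
    | succ k ih =>
      have : a ^ n * (a * b) = a ^ n := by
        rw [mul_sub, mul_one] at hn; exact (sub_eq_zero.1 hn).symm
      rw [pow_succ', ← mul_assoc, this, ih]
  have hcab : Commute a (a * b) := (Commute.refl a).mul_right hab
  -- Since `a * b` acts as the identity on `a ^ n`, the power `(a * b) ^ (n + 1)`, a multiple of `a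
  -- ^ n`, is idempotent; it is the product of `a` with the Drazin inverse `a ^ n * b ^ (n + 1)`.
  have hidem : (a * b) ^ (n + 1) * (a * b) ^ (n + 1) = (a * b) ^ (n + 1) := by
    have : (a * b) ^ (n + 1) = b ^ (n + 1) * a * a ^ n := by
      rw [hab.mul_pow, (hab.pow_pow _ _).eq, mul_assoc, ← pow_succ']
    nth_rewrite 1 [this]
    rw [mul_assoc, hk, ← this]
  have hac : a * (a ^ n * b ^ (n + 1)) = (a * b) ^ (n + 1) := by
    rw [← mul_assoc, ← pow_succ', hab.mul_pow]
  have hcs : Commute a (a ^ n * b ^ (n + 1)) :=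
    ((Commute.refl a).pow_right n).mul_right (hab.pow_right _)
  have hsas : a ^ n * b ^ (n + 1) * a * (a ^ n * b ^ (n + 1)) = a ^ n * b ^ (n + 1) := by
    rw [← hcs.eq, hac, ← mul_assoc, ← (hcab.pow_right (n + 1)).pow_left n |>.eq, hk]
  have hzero : a ^ n * (1 - a * (a ^ n * b ^ (n + 1))) = 0 := by
    rw [hac, mul_sub, mul_one, hk, sub_self]
  refine ⟨a ^ n * b ^ (n + 1), hcs, hsas, ⟨n, hzero⟩, ?_, fun c hc =>
    commute_drazinInverse hcs hsas hzero hc⟩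
  -- By the geometric sum the new residue is a multiple of the old one `1 - a * b`.
  rw [hac, ← mul_neg_geom_sum]
  exact J.mul_mem_right _ _ hJ

/-- Drazin inverses lie in bicommutants, so all four elements commute and the inverses can simply be
multiplied. -/
lemma RegularMod.mul (ha : RegularMod J a) (hb : RegularMod J b) (hab : Commute a b) :
    RegularMod J (a * b) := by
  obtain ⟨s, has, -, ⟨n, hn⟩, hs, hs'⟩ := ha.exists_drazinInverse
  obtain ⟨t, hbt, -, ⟨m, hm⟩, ht, ht'⟩ := hb.exists_drazinInverse
  have hsb : Commute s b := hs' b hab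
  have hat : Commute a t := (ht' a hab.symm).symm
  have hst : Commute s t := hs' t hat
  have h1 : a * b * (s * t) = (a * s) * (b * t) := by
    rw [mul_assoc a b, ← mul_assoc b, ← hsb.eq]; simp only [mul_assoc]
  have h2 : 1 - a * b * (s * t) = (1 - a * s) + (a * s) * (1 - b * t) := by
    rw [h1]; noncomm_ring
  refine ⟨s * t, (has.mul_right hat).mul_left (hsb.symm.mul_right hbt), ⟨max n m, ?_⟩, ?_⟩
  · have e1 := pow_mul_eq_zero_of_le hn (le_max_left n m)
    have e2 := pow_mul_eq_zero_of_le hm (le_max_right n m)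
    have c1 : Commute (b ^ max n m) (a * s) :=
      ((hab.symm.mul_right hsb.symm)).pow_left _
    rw [h2, mul_add, hab.mul_pow]
    nth_rewrite 1 [(hab.pow_pow _ _).eq]
    rw [mul_assoc, e1, mul_zero, zero_add, mul_assoc, ← mul_assoc (b ^ _), c1.eq,
      mul_assoc (a * s), e2, mul_zero, mul_zero]
  · rw [h2]
    exact J.add_mem hs (J.mul_mem_left _ _ ht)

lemma RegularMod.one : RegularMod J (1 : R) :=
  ⟨1, Commute.refl _, ⟨0, by simp⟩, by simp⟩

lemma RegularMod.of_pow {k : ℕ} (hk : k ≠ 0) (h : RegularMod J (a ^ k)) : RegularMod J a := by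
  obtain ⟨s, -, -, ⟨n, hn⟩, hs, hs'⟩ := h.exists_drazinInverse
  obtain ⟨k, rfl⟩ := Nat.exists_eq_succ_of_ne_zero hk
  have has : Commute a s := (hs' a ((Commute.refl a).pow_left _)).symm
  have e : a * (a ^ k * s) = a ^ (k + 1) * s := by rw [← mul_assoc, ← pow_succ']
  refine ⟨a ^ k * s, ((Commute.refl a).pow_right k).mul_right has, ⟨(k + 1) * n, ?_⟩, ?_⟩
  · rw [e, pow_mul]; exact hn
  · rw [e]; exact hs

lemma regularMod_bot_iff : RegularMod (⊥ : TwoSidedIdeal R) a ↔ IsUnit a := by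
  constructor
  · rintro ⟨b, hab, -, h⟩
    have h1 : a * b = 1 := (sub_eq_zero.1 ((TwoSidedIdeal.mem_bot R).1 h)).symm
    exact ⟨⟨a, b, h1, hab.eq ▸ h1⟩, rfl⟩
  · rintro ⟨u, rfl⟩
    exact ⟨↑u⁻¹, by simp [Commute, SemiconjBy], ⟨0, by simp⟩, by simp⟩

lemma RegularMod.mono {J K : TwoSidedIdeal R} (hJK : J ≤ K) (h : RegularMod J a) :
    RegularMod K a := by
  obtain ⟨b, hab, hn, hJ⟩ := h
  exact ⟨b, hab, hn, hJK hJ⟩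

end Ring

/-! ### Spectral mapping and isolation of regular points -/

section Polynomial

open Polynomial

variable {K R : Type*} [Field K] [Ring R] [Algebra K R] {J : TwoSidedIdeal R} {a : R}

lemma commute_aeval_aeval (a : R) (p q : K[X]) : Commute (aeval a p) (aeval a q) := by
  rw [Commute, SemiconjBy, ← map_mul, ← map_mul, mul_comm]

/-- Off the residue `e` of `p * q`, the element `q * s` inverts `p`. On `e`, Bézout for `p ^ (n +
1)` and `q ^ (n + 1)` makes `u * p ^ n` an inverse up to `v * q ^ (n + 1)`, which `p ^ (n + 1)`
annihilates there. -/
lemma RegularMod.of_isCoprime {p q : K[X]} (hpq : IsCoprime p q)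
    (h : RegularMod J (aeval a (p * q))) : RegularMod J (aeval a p) := by
  obtain ⟨s, -, -, ⟨n, hn⟩, hs, hs'⟩ := h.exists_drazinInverse
  have hcs : ∀ r : K[X], Commute s (aeval a r) := fun r => hs' _ (commute_aeval_aeval a _ r)
  have hn1 := pow_mul_eq_zero_of_le hn n.le_succ
  obtain ⟨u, v, huv⟩ := (hpq.pow : IsCoprime (p ^ (n + 1)) (q ^ (n + 1)))
  set e := 1 - aeval a (p * q) * s with he
  have hce : ∀ r : K[X], Commute (aeval a r) e := fun r =>
    (Commute.one_right _).sub_right ((commute_aeval_aeval a r _).mul_right (hcs r).symm)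
  have key : 1 - aeval a p * (aeval a q * s + aeval a (u * p ^ n) * e)
      = aeval a (v * q ^ (n + 1)) * e := by
    have h1 : aeval a p * (aeval a q * s) = 1 - e := by
      rw [he, map_mul]; noncomm_ring
    have h2 : aeval a p * (aeval a (u * p ^ n) * e) = aeval a (u * p ^ (n + 1)) * e := by
      rw [← mul_assoc, ← map_mul]; congr 2; ring
    have h3 : aeval a (v * q ^ (n + 1)) = 1 - aeval a (u * p ^ (n + 1)) := by
      rw [← map_one (aeval a (R := K)), ← map_sub, ← huv]; congr 1; ring
    rw [mul_add, h1, h2, h3, sub_mul, one_mul]; abel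
  refine ⟨aeval a q * s + aeval a (u * p ^ n) * e, ?_, ⟨n + 1, ?_⟩, ?_⟩
  · exact ((commute_aeval_aeval a _ _).mul_right (hcs p).symm).add_right
      ((commute_aeval_aeval a _ _).mul_right (hce p))
  · rw [key, ← mul_assoc, ← map_pow, ← map_mul,
      show p ^ (n + 1) * (v * q ^ (n + 1)) = v * (p * q) ^ (n + 1) by ring, map_mul, map_pow,
      mul_assoc, hn1, mul_zero]
  · rw [key]; exact J.mul_mem_left _ _ hs

/-- Spectral mapping for regularity modulo an ideal. -/
lemma regularMod_aeval_iff [IsAlgClosed K] {p : K[X]} (hm : p.Monic) :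
    RegularMod J (aeval a p) ↔ ∀ z, p.IsRoot z → RegularMod J (a - algebraMap K R z) := by
  have hp := hm.ne_zero
  constructor
  · intro h z hz
    -- Splitting off the full power of `X - z` leaves a coprime cofactor, which can be discarded;
    -- the power is then removed by `RegularMod.of_pow`.
    obtain ⟨q, hq, hndvd⟩ := exists_eq_pow_rootMultiplicity_mul_and_not_dvd p hp z
    have hcop : IsCoprime ((X - C z) ^ rootMultiplicity z p) q :=
      (((prime_X_sub_C z).irreducible.coprime_iff_not_dvd).2 hndvd).pow_left
    rw [hq] at h
    have h1 := RegularMod.of_isCoprime hcop h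
    rw [map_pow] at h1
    simpa using h1.of_pow ((rootMultiplicity_pos hp).2 hz).ne'
  · intro h
    have hsplit : p = (p.roots.map fun z => X - C z).prod := by
      have := (IsAlgClosed.splits p).eq_prod_roots
      simpa [hm.leadingCoeff] using this
    have : ∀ s : Multiset K, (∀ z ∈ s, RegularMod J (a - algebraMap K R z)) →
        RegularMod J (aeval a (s.map fun z => X - C z).prod) := by
      intro s
      induction s using Multiset.induction_on with
      | empty => intro _; simpa using RegularMod.one
      | cons z s ih =>
        intro hs
        rw [Multiset.map_cons, Multiset.prod_cons, map_mul]
        refine RegularMod.mul ?_ (ih fun y hy => hs y (Multiset.mem_cons_of_mem hy))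
          (commute_aeval_aeval a _ _)
        simpa using hs z (Multiset.mem_cons_self z s)
    rw [hsplit]
    exact this _ fun z hz => h z ((mem_roots hp).1 hz)

lemma regularMod_pow_sub_iff [IsAlgClosed K] {m : ℕ} (hm : m ≠ 0) (w : K) :
    RegularMod J (a ^ m - algebraMap K R w) ↔
      ∀ z, z ^ m = w → RegularMod J (a - algebraMap K R z) := by
  have := regularMod_aeval_iff (J := J) (a := a) (monic_X_pow_sub_C w hm)
  simpa [sub_eq_zero] using this

/-- A regular element becomes a unit under small nonzero scalar perturbations. -/
lemma RegularMod.eventually_isUnit {R : Type*} [NormedRing R] [NormedAlgebra ℂ R]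
    [CompleteSpace R] {J : TwoSidedIdeal R} {a : R} (h : RegularMod J a) :
    ∀ᶠ z in 𝓝[≠] (0 : ℂ), IsUnit (a - algebraMap ℂ R z) := by
  obtain ⟨s, has, hsas, ⟨n, hn⟩, -, -⟩ := h.exists_drazinInverse
  have hunit : ∀ᶠ z in 𝓝[≠] (0 : ℂ), IsUnit (1 - algebraMap ℂ R z * s) := by
    refine Filter.Eventually.filter_mono nhdsWithin_le_nhds ?_
    have hc : Continuous fun z : ℂ => 1 - algebraMap ℂ R z * s := by
      have := continuous_algebraMap ℂ R
      fun_prop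
    have := hc.continuousAt.preimage_mem_nhds (x := 0)
      (Units.isOpen.mem_nhds (x := 1 - algebraMap ℂ R 0 * s) (by simp))
    exact this
  filter_upwards [hunit, self_mem_nhdsWithin] with z ⟨u, hu⟩ hz
  set ζ := algebraMap ℂ R z with hζ
  have hcz : ∀ x : R, Commute ζ x := fun x => Algebra.commutes z x
  set p := a * s with hp
  have hca : Commute (a - ζ) s := has.sub_left (hcz s)
  have hcp : Commute (a - ζ) (1 - p) := (Commute.one_right _).sub_right
    (((Commute.refl a).sub_left (hcz a)).mul_right hca)
  have hcu : Commute (a - ζ) ↑u⁻¹ := by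
    refine Commute.units_inv_right ?_
    rw [hu]
    exact (Commute.one_right _).sub_right ((hcz _).symm.mul_right hca)
  have hps : p * s = s := by rw [hp, has.eq, hsas]
  -- On the range of `p` the inverse of `a - ζ` is `s * (1 - ζ * s)⁻¹`. On that of `1 - p`, where `a
  -- ^ n = 0`, it comes from factoring `ζ ^ n - a ^ n` and dividing by `z ^ n`.
  have h1 : (a - ζ) * (s * ↑u⁻¹) = p := by
    have : (a - ζ) * s = p * u := by
      rw [hu, mul_sub, mul_one, ← mul_assoc, ← (hcz p).eq, mul_assoc ζ p s, hps, sub_mul]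
    rw [← mul_assoc, this, mul_assoc, u.mul_inv, mul_one]
  obtain ⟨y, hy⟩ : ∃ y, (a - ζ) * y = ζ ^ n - a ^ n ∧ Commute (a - ζ) y := by
    refine ⟨-∑ i ∈ Finset.range n, a ^ i * ζ ^ (n - 1 - i), ?_, ?_⟩
    · rw [mul_neg, (hcz a).symm.mul_geom_sum₂, neg_sub]
    · refine (Commute.sum_right _ _ _ fun i _ => ?_).neg_right
      exact (((Commute.refl a).sub_left (hcz a)).pow_right i).mul_right ((hcz _).symm.pow_right _)
  have h2 : (a - ζ) * (y * (algebraMap ℂ R (z ^ n)⁻¹ * (1 - p))) = 1 - p := by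
    rw [← mul_assoc, hy.1, ← mul_assoc, ← Algebra.commutes, mul_assoc, sub_mul, hn, sub_zero,
      hζ, ← map_pow, ← mul_assoc, ← map_mul, inv_mul_cancel₀ (pow_ne_zero n hz), map_one, one_mul]
  have hright : (a - ζ) * (s * ↑u⁻¹ + y * (algebraMap ℂ R (z ^ n)⁻¹ * (1 - p))) = 1 := by
    rw [mul_add, h1, h2]; abel
  have hcom : Commute (a - ζ) (s * ↑u⁻¹ + y * (algebraMap ℂ R (z ^ n)⁻¹ * (1 - p))) :=
    (hca.mul_right hcu).add_right (hy.2.mul_right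
      ((show Commute (algebraMap ℂ R (z ^ n)⁻¹) (a - ζ) from
        Algebra.commutes _ _).symm.mul_right hcp))
  exact ⟨⟨_, _, hright, by rw [← hcom.eq, hright]⟩, rfl⟩

lemma RegularMod.eventually_notMem_spectrum {R : Type*} [NormedRing R] [NormedAlgebra ℂ R]
    [CompleteSpace R] {J : TwoSidedIdeal R} {a : R} (h : RegularMod J a) :
    ∀ᶠ z in 𝓝[≠] (0 : ℂ), z ∉ spectrum ℂ a := by
  filter_upwards [h.eventually_isUnit] with z hz
  rwa [spectrum.notMem_iff, ← IsUnit.neg_iff, neg_sub]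

end Polynomial

/-! ### Riesz idempotents as limits of `(1 - b ^ 2 ^ k)⁻¹`, without contour integrals -/

section RieszIdempotent

lemma commute_ringInverse {R : Type*} [MonoidWithZero R] {a y : R} (h : Commute a y)
    (hy : IsUnit y) : Commute a (Ring.inverse y) := by
  obtain ⟨v, rfl⟩ := hy
  rw [Ring.inverse_unit]
  exact h.units_inv_right

/-- Gluing units along a commuting idempotent. -/
lemma isUnit_mul_add_mul {R : Type*} [Ring R] {e x y : R} (he : e * e = e) (hx : IsUnit x)
    (hy : IsUnit y) (hxe : Commute x e) (hye : Commute y e) :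
    IsUnit (x * (1 - e) + y * e) := by
  obtain ⟨v, rfl⟩ := hx
  obtain ⟨w, rfl⟩ := hy
  have hv' : Commute (↑v⁻¹ : R) e := hxe.units_inv_left
  have hw' : Commute (↑w⁻¹ : R) e := hye.units_inv_left
  have hfe : (1 - e) * e = 0 := by rw [sub_mul, he, one_mul, sub_self]
  have hf : (1 - e) * (1 - e) = 1 - e := by rw [mul_sub, mul_one, hfe, sub_zero]
  have hef : e * (1 - e) = 0 := by rw [mul_sub, he, mul_one, sub_self]
  have key : ∀ {p q p' q' : R}, p * p' = 1 → q * q' = 1 → Commute p' e → Commute q' e →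
      (p * (1 - e) + q * e) * (p' * (1 - e) + q' * e) = 1 := by
    intro p q p' q' hp hq hp' hq'
    have hp1 : (1 - e) * p' = p' * (1 - e) :=
      ((Commute.one_right p').sub_right hp').eq.symm
    calc (p * (1 - e) + q * e) * (p' * (1 - e) + q' * e)
        = p * ((1 - e) * p') * (1 - e) + p * (1 - e) * (q' * e) + q * (e * p') * (1 - e)
          + q * (e * q') * e := by noncomm_ring
      _ = p * p' * ((1 - e) * (1 - e)) + p * ((1 - e) * e) * q' + q * p' * (e * (1 - e))
          + q * q' * (e * e) := by
          rw [hp1, ← hp'.eq, ← hq'.eq]; simp only [mul_assoc]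
          rw [hq'.eq]
      _ = 1 := by rw [hp, hq, hf, hfe, hef, he]; simp
  exact ⟨⟨_, _, key v.mul_inv w.mul_inv hv' hw', key v.inv_mul w.inv_mul hxe hye⟩, rfl⟩

variable {A : Type*} [NormedRing A] [NormedAlgebra ℂ A]

/-- The resolvent-type function `λ ↦ (1 - (λ b) ^ (2 ^ k))⁻¹`. -/
noncomputable def powResolvent (b : A) (k : ℕ) (z : ℂ) : A := Ring.inverse (1 - (z • b) ^ 2 ^ k)

/-- A primitive `2 ^ (k + 1)`-th root of unity. -/
noncomputable def halfTurnRoot (k : ℕ) : ℂ := Complex.exp (Complex.I * (Real.pi / 2 ^ k : ℝ))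

lemma norm_halfTurnRoot (k : ℕ) : ‖halfTurnRoot k‖ = 1 := Complex.norm_exp_I_mul_ofReal _

lemma halfTurnRoot_pow (k : ℕ) : halfTurnRoot k ^ 2 ^ k = -1 := by
  rw [halfTurnRoot, ← Complex.exp_nat_mul, ← Complex.exp_pi_mul_I]
  congr 1
  push_cast
  field_simp

lemma norm_halfTurnRoot_sub_one_le (k : ℕ) : ‖halfTurnRoot k - 1‖ ≤ Real.pi / 2 ^ k := by
  refine Real.norm_exp_I_mul_ofReal_sub_one_le.trans ?_
  rw [Real.norm_of_nonneg (by positivity)]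

lemma rotate_pow (b : A) (k : ℕ) (z : ℂ) :
    ((z * halfTurnRoot k) • b) ^ 2 ^ k = -(z • b) ^ 2 ^ k := by
  rw [mul_comm, mul_smul, smul_pow, halfTurnRoot_pow, neg_smul, one_smul]

section

variable {b : A} (hb : ∀ z : ℂ, ‖z‖ = 1 → IsUnit (1 - z • b))
include hb

/-- Induction through `1 - x² = (1 - x)(1 + x)`: rotating `z` by `halfTurnRoot k` changes the sign
of `x = (z • b) ^ 2 ^ k`. -/
lemma isUnit_one_sub_smul_pow (k : ℕ) (z : ℂ) (hz : ‖z‖ = 1) :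
    IsUnit (1 - (z • b) ^ 2 ^ k) := by
  induction k generalizing z with
  | zero => simpa using hb z hz
  | succ k ih =>
    have h2 := ih (z * halfTurnRoot k) (by rw [norm_mul, hz, norm_halfTurnRoot, one_mul])
    rw [rotate_pow, sub_neg_eq_add] at h2
    have : 1 - (z • b) ^ 2 ^ (k + 1) = (1 - (z • b) ^ 2 ^ k) * (1 + (z • b) ^ 2 ^ k) := by
      rw [pow_succ 2 k, pow_mul]; noncomm_ring
    rw [this]
    exact (ih z hz).mul h2

lemma powResolvent_succ_eq_mul (k : ℕ) (z : ℂ) (hz : ‖z‖ = 1) :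
    powResolvent b (k + 1) z = powResolvent b k (z * halfTurnRoot k) * powResolvent b k z := by
  have h1 := isUnit_one_sub_smul_pow hb k z hz
  rw [powResolvent, powResolvent, powResolvent, rotate_pow, sub_neg_eq_add,
    ← Ring.inverse_mul (Or.inl h1)]
  congr 1
  rw [pow_succ 2 k, pow_mul]; noncomm_ring

/-- Partial fractions, `(1 - x²)⁻¹ = ½((1 - x)⁻¹ + (1 + x)⁻¹)`. Iterated, this is a Riemann sum over
roots of unity for the Riesz integral. -/
lemma powResolvent_succ_eq_average (k : ℕ) (z : ℂ) (hz : ‖z‖ = 1) :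
    powResolvent b (k + 1) z =
      (2⁻¹ : ℂ) • (powResolvent b k z + powResolvent b k (z * halfTurnRoot k)) := by
  have h1 := isUnit_one_sub_smul_pow hb k z hz
  have h2 := isUnit_one_sub_smul_pow hb k (z * halfTurnRoot k)
    (by rw [norm_mul, hz, norm_halfTurnRoot, one_mul])
  rw [powResolvent_succ_eq_mul hb k z hz]
  rw [powResolvent, powResolvent]
  rw [rotate_pow, sub_neg_eq_add] at *
  set x := (z • b) ^ 2 ^ k
  obtain ⟨p, hp⟩ := h1
  obtain ⟨q, hq⟩ := h2
  rw [← hp, ← hq, Ring.inverse_unit, Ring.inverse_unit]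
  have hsum : (p : A) + q = (2 : ℂ) • 1 := by rw [hp, hq, two_smul]; abel
  have : (↑p⁻¹ : A) + ↑q⁻¹ = (2 : ℂ) • (↑q⁻¹ * ↑p⁻¹) := by
    calc (↑p⁻¹ : A) + ↑q⁻¹ = ↑q⁻¹ * (p + q) * ↑p⁻¹ := by
          rw [mul_add, add_mul, mul_assoc, p.mul_inv, q.inv_mul, mul_one, one_mul, add_comm]
      _ = _ := by rw [hsum]; simp
  rw [this, smul_smul]; simp

variable [CompleteSpace A]

/-- The resolvent identity bounds the case `k = 0` on the circle; averaging over rotations preserves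
the constant, so it does not depend on `k`. -/
lemma exists_lipschitz_powResolvent :
    ∃ K : ℝ, ∀ (k : ℕ) (z y : ℂ), ‖z‖ = 1 → ‖y‖ = 1 →
      ‖powResolvent b k z - powResolvent b k y‖ ≤ K * ‖z - y‖ := by
  have hcont : ContinuousOn (fun z : ℂ => ‖Ring.inverse (1 - z • b)‖) (Metric.sphere 0 1) := by
    intro z hz
    obtain ⟨v, hv⟩ := hb z (by simpa using hz)
    have h1 : ContinuousAt Ring.inverse (1 - z • b) := hv ▸ NormedRing.inverse_continuousAt v
    have h2 : ContinuousAt (fun z : ℂ => 1 - z • b) z := by fun_prop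
    exact (ContinuousAt.comp (f := fun z : ℂ => 1 - z • b) h1 h2).norm.continuousWithinAt
  obtain ⟨C, hC⟩ := (isCompact_sphere (0 : ℂ) 1).bddAbove_image hcont
  have hC' : ∀ z : ℂ, ‖z‖ = 1 → ‖Ring.inverse (1 - z • b)‖ ≤ C := fun z hz =>
    hC ⟨z, by simpa using hz, rfl⟩
  have hC0 : 0 ≤ C := (norm_nonneg _).trans (hC' 1 (by simp))
  refine ⟨C * ‖b‖ * C, fun k => ?_⟩
  induction k with
  | zero =>
    intro z y hz hy
    have e1 : powResolvent b 0 z - powResolvent b 0 y =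
        (z - y) • (Ring.inverse (1 - z • b) * b * Ring.inverse (1 - y • b)) := by
      simp only [powResolvent, pow_zero, pow_one]
      obtain ⟨p, hp⟩ := hb z hz
      obtain ⟨q, hq⟩ := hb y hy
      rw [← hp, ← hq, Ring.inverse_unit, Ring.inverse_unit]
      have : (z - y) • b = q - p := by rw [hp, hq, sub_smul]; abel
      rw [← smul_mul_assoc, ← mul_smul_comm, this, mul_sub, sub_mul, p.inv_mul, mul_assoc,
        q.mul_inv, mul_one, one_mul]
    rw [e1, norm_smul, mul_comm]
    gcongr
    refine (norm_mul_le _ _).trans ?_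
    gcongr
    · refine (norm_mul_le _ _).trans ?_
      gcongr
      exact hC' z hz
    · exact hC' y hy
  | succ k ih =>
    intro z y hz hy
    rw [powResolvent_succ_eq_average hb k z hz, powResolvent_succ_eq_average hb k y hy,
      ← smul_sub, add_sub_add_comm, norm_smul]
    have h1 := ih z y hz hy
    have h2 := ih (z * halfTurnRoot k) (y * halfTurnRoot k)
      (by rw [norm_mul, hz, norm_halfTurnRoot, one_mul])
      (by rw [norm_mul, hy, norm_halfTurnRoot, one_mul])
    rw [← sub_mul, norm_mul, norm_halfTurnRoot, mul_one] at h2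
    have h3 := norm_add_le (powResolvent b k z - powResolvent b k y)
      (powResolvent b k (z * halfTurnRoot k) - powResolvent b k (y * halfTurnRoot k))
    rw [norm_inv, RCLike.norm_ofNat]
    linarith

/-- The Riesz idempotent of the part of the spectrum inside the unit disc. -/
lemma exists_tendsto_powResolvent :
    ∃ e : A, Tendsto (fun k => powResolvent b k 1) atTop (𝓝 e) ∧ e * e = e := by
  obtain ⟨K, hK⟩ := exists_lipschitz_powResolvent hb
  have h0 : ∀ k, ‖powResolvent b k 1 - powResolvent b k (1 * halfTurnRoot k)‖
      ≤ K * ‖halfTurnRoot k - 1‖ := fun k => by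
    rw [norm_sub_rev (halfTurnRoot k)]
    simpa using hK k 1 (1 * halfTurnRoot k) (by simp) (by simp [norm_halfTurnRoot])
  have hK0 : 0 ≤ K := by
    have := (norm_nonneg _).trans (hK 0 1 (-1) (by simp) (by simp))
    exact nonneg_of_mul_nonneg_left this (by norm_num)
  have hcauchy : CauchySeq fun k => powResolvent b k 1 := by
    refine cauchySeq_of_le_geometric_two (C := K * Real.pi) fun k => ?_
    have : powResolvent b k 1 - powResolvent b (k + 1) 1 =
        (2⁻¹ : ℂ) • (powResolvent b k 1 - powResolvent b k (1 * halfTurnRoot k)) := by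
      rw [powResolvent_succ_eq_average hb k 1 (by simp), smul_add, smul_sub]
      have : powResolvent b k 1 = (2⁻¹ : ℂ) • powResolvent b k 1
          + (2⁻¹ : ℂ) • powResolvent b k 1 := by
        rw [← add_smul]; norm_num
      nth_rewrite 1 [this]
      abel
    rw [dist_eq_norm, this, norm_smul, norm_inv, RCLike.norm_ofNat]
    have h1 := (h0 k).trans (mul_le_mul_of_nonneg_left (norm_halfTurnRoot_sub_one_le k) hK0)
    calc (2 : ℝ)⁻¹ * ‖powResolvent b k 1 - powResolvent b k (1 * halfTurnRoot k)‖
        ≤ 2⁻¹ * (K * (Real.pi / 2 ^ k)) := by gcongr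
      _ = K * Real.pi / 2 / 2 ^ k := by ring
  obtain ⟨e, he⟩ := cauchySeq_tendsto_of_complete hcauchy
  have hdiff : Tendsto (fun k => powResolvent b k 1 - powResolvent b k (1 * halfTurnRoot k))
      atTop (𝓝 0) := by
    refine squeeze_zero_norm (fun k => (h0 k).trans
      (mul_le_mul_of_nonneg_left (norm_halfTurnRoot_sub_one_le k) hK0)) ?_
    have : Tendsto (fun k : ℕ => K * (Real.pi * (1 / 2) ^ k)) atTop (𝓝 (K * (Real.pi * 0))) :=
      ((tendsto_pow_atTop_nhds_zero_of_lt_one (by norm_num) (by norm_num)).const_mul _).const_mul _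
    simpa [div_eq_mul_inv] using this
  have he' : Tendsto (fun k => powResolvent b k (1 * halfTurnRoot k)) atTop (𝓝 e) := by
    simpa using he.sub hdiff
  -- The product formula for `powResolvent b (k + 1) 1` has both factors tending to `e`, whence `e =
  -- e * e`.
  refine ⟨e, he, tendsto_nhds_unique (he'.mul he) ?_⟩
  have := (tendsto_add_atTop_iff_nat 1).2 he
  exact this.congr fun k => powResolvent_succ_eq_mul hb k 1 (by simp)

/-- The Riesz decomposition with respect to the unit circle. -/
lemma exists_rieszIdempotent_unitCircle :
    ∃ e : A, e * e = e ∧ Commute b e ∧ IsUnit (b * (1 - e) + e) ∧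
      ∀ z ∈ spectrum ℂ (b * e), ‖z‖ ≤ 1 := by
  obtain ⟨e, he, hee⟩ := exists_tendsto_powResolvent hb
  set E : ℕ → A := fun k => powResolvent b k 1 with hE
  have hu : ∀ k, IsUnit (1 - b ^ 2 ^ k) := fun k => by
    simpa using isUnit_one_sub_smul_pow hb k 1 (by simp)
  have hEdef : ∀ k, E k = Ring.inverse (1 - b ^ 2 ^ k) := fun k => by simp [hE, powResolvent]
  have hbE : ∀ k, Commute b (E k) := fun k => by
    rw [hEdef]
    exact commute_ringInverse
      ((Commute.one_right b).sub_right ((Commute.refl b).pow_right _)) (hu k)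
  have hbe : Commute b e :=
    tendsto_nhds_unique (he.const_mul b) ((he.mul_const b).congr fun k => (hbE k).eq.symm)
  have hcancel : ∀ k, E k * (1 - b ^ 2 ^ k) = 1 := fun k => by
    rw [hEdef, Ring.inverse_mul_cancel _ (hu k)]
  have hpow : ∀ k, b ^ 2 ^ k = (E k - 1) * (1 - b ^ 2 ^ k) := fun k => by
    rw [sub_mul, hcancel]; noncomm_ring
  have hEe : ∀ k, Commute (E k) e := fun k => by
    rw [hEdef]
    exact (commute_ringInverse ((Commute.one_right e).sub_right (hbe.symm.pow_right _))
      (hu k)).symm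
  have hfe : (1 - e) * e = 0 := by rw [sub_mul, hee, one_mul, sub_self]
  have hf : (1 - e) * (1 - e) = 1 - e := by rw [mul_sub, mul_one, hfe, sub_zero]
  refine ⟨e, hee, hbe, ?_, ?_⟩
  -- Outer part: once `E k * (1 - e)` has norm below `1`, the element `b ^ 2 ^ k * (1 - e) + e` is a
  -- unit, and it is a power of `b * (1 - e) + e`.
  · have hlim : Tendsto (fun k => ‖E k * (1 - e)‖) atTop (𝓝 0) := by
      have := (he.mul_const (1 - e)).norm
      rwa [mul_sub, hee, mul_one, sub_self, norm_zero] at this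
    obtain ⟨k, hk⟩ := (hlim.eventually_lt_const one_pos).exists
    have hun := isUnit_one_sub_of_norm_lt_one hk
    have hce : Commute (1 - E k * (1 - e)) e := (Commute.one_left e).sub_left
      ((hEe k).mul_left ((Commute.one_left e).sub_left (Commute.refl e)))
    have hcb : Commute (1 - b ^ 2 ^ k) e := (Commute.one_left e).sub_left (hbe.pow_left _)
    have key := isUnit_mul_add_mul hee ((hun.mul (hu k)).neg) isUnit_one
      ((hce.mul_left hcb).neg_left) (Commute.one_left e)
    have hmain : -((1 - E k * (1 - e)) * (1 - b ^ 2 ^ k)) * (1 - e) + 1 * e =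
        b ^ 2 ^ k * (1 - e) + e := by
      have hcb' : (1 - b ^ 2 ^ k) * (1 - e) = (1 - e) * (1 - b ^ 2 ^ k) :=
        ((Commute.one_right _).sub_right hcb).eq
      have : b ^ 2 ^ k * (1 - e) = (E k - 1) * ((1 - e) * (1 - b ^ 2 ^ k)) := by
        conv_lhs => rw [hpow k, mul_assoc, hcb']
      rw [one_mul, this, neg_mul, mul_assoc, hcb']
      have h3 : (1 - E k * (1 - e)) * ((1 - e) * (1 - b ^ 2 ^ k)) =
          (1 - e) * (1 - b ^ 2 ^ k) - E k * ((1 - e) * (1 - e)) * (1 - b ^ 2 ^ k) := by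
        noncomm_ring
      rw [h3, hf]
      noncomm_ring
    rw [hmain] at key
    have hpw : ∀ n : ℕ, (b * (1 - e) + e) ^ n = b ^ n * (1 - e) + e := by
      intro n
      induction n with
      | zero => simp
      | succ n ih =>
        have h1 : (1 - e) * b = b * (1 - e) := ((Commute.one_right b).sub_right hbe).eq.symm
        rw [pow_succ, ih]
        calc (b ^ n * (1 - e) + e) * (b * (1 - e) + e)
            = b ^ n * ((1 - e) * b) * (1 - e) + b ^ n * ((1 - e) * e) + (e * b) * (1 - e)
              + e * e := by noncomm_ring
          _ = b ^ n * b * ((1 - e) * (1 - e)) + b * (e * (1 - e)) + e := by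
            rw [h1, hfe, ← hbe.eq, hee]; simp only [mul_assoc, mul_zero, add_zero]
          _ = b ^ (n + 1) * (1 - e) + e := by
            rw [hf, mul_sub e, hee, pow_succ]; simp
    rw [← hpw] at key
    exact (isUnit_pow_iff (pow_ne_zero k two_ne_zero)).1 key
  · have hlim : Tendsto (fun k => ‖(E k - 1) * e‖) atTop (𝓝 0) := by
      have := ((he.sub_const 1).mul_const e).norm
      rwa [sub_mul, hee, one_mul, sub_self, norm_zero] at this
    -- Inner part: the threshold forces `‖c‖ * ‖1‖ ≤ 1` for `c = (b * e) ^ 2 ^ k`. The norm of `1`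
    -- enters because it is not assumed to equal `1`.
    have hδ : 0 < 1 / (2 * (1 + ‖(1 : A)‖ * ‖(1 : A)‖)) := by positivity
    obtain ⟨k, hk⟩ := (hlim.eventually_lt_const hδ).exists
    set x := (E k - 1) * e with hx
    set c := b ^ 2 ^ k * e with hc
    have hcx : c = x * (1 - c) := by
      have h1 : x * (1 - c) = (E k - 1) * e - (E k - 1) * (e * b ^ 2 ^ k) * e := by
        rw [hx, hc]; noncomm_ring
      have h2 : (E k - 1) * (b ^ 2 ^ k * e) * e = (E k - 1) * (b ^ 2 ^ k) * e := by
        rw [mul_assoc, mul_assoc _ e e, hee, mul_assoc]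
      rw [h1, ← (hbe.pow_left _).eq, h2, hc]
      conv_lhs => rw [hpow k]
      rw [mul_sub, mul_one, sub_mul]
    have hcn : ‖c‖ ≤ ‖x‖ * (‖(1 : A)‖ + ‖c‖) := by
      conv_lhs => rw [hcx]
      exact (norm_mul_le _ _).trans (by gcongr; exact norm_sub_le _ _)
    have hc1 : ‖c‖ * ‖(1 : A)‖ ≤ 1 := by
      have h1 : 0 ≤ ‖(1 : A)‖ := norm_nonneg _
      set o := ‖(1 : A)‖
      have hk' : ‖x‖ * (2 * (1 + o * o)) < 1 := by
        rwa [lt_div_iff₀ (by positivity)] at hk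
      have hx0 : 0 ≤ ‖x‖ := norm_nonneg x
      have hx1 : ‖x‖ ≤ 1 / 2 := by nlinarith [mul_nonneg hx0 (mul_nonneg h1 h1)]
      have hc2 : ‖c‖ ≤ 2 * ‖x‖ * o := by
        nlinarith [mul_le_mul_of_nonneg_right hx1 (norm_nonneg c)]
      calc ‖c‖ * o ≤ 2 * ‖x‖ * o * o := by gcongr
        _ ≤ 1 := by nlinarith
    intro z hz
    have hz2 : z ^ 2 ^ k ∈ spectrum ℂ ((b * e) ^ 2 ^ k) := spectrum.pow_mem_pow _ _ hz
    have he2 : e ^ 2 ^ k = e := IsIdempotentElem.pow_eq (hn := pow_ne_zero k two_ne_zero) hee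
    rw [hbe.mul_pow, he2] at hz2
    have := (spectrum.norm_le_norm_mul_of_mem hz2).trans hc1
    rw [norm_pow] at this
    exact (pow_le_one_iff_of_nonneg (norm_nonneg z) (pow_ne_zero k two_ne_zero)).1 this

end

variable [CompleteSpace A]

/-- The Riesz decomposition with respect to a circle that does not meet the spectrum. -/
lemma exists_rieszIdempotent (a : A) {r : ℝ} (hr : 0 < r) (ha : ∀ z ∈ spectrum ℂ a, ‖z‖ ≠ r) :
    ∃ e : A, e * e = e ∧ Commute a e ∧ IsUnit (a * (1 - e) + e) ∧
      ∀ z ∈ spectrum ℂ (a * e), ‖z‖ ≤ r ∧ (z = 0 ∨ z ∈ spectrum ℂ a) := by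
  have hr0 : (r : ℂ) ≠ 0 := by exact_mod_cast hr.ne'
  have hb : ∀ z : ℂ, ‖z‖ = 1 → IsUnit (1 - z • ((r : ℂ)⁻¹ • a)) := by
    intro z hz
    have hz0 : z ≠ 0 := by rintro rfl; simp at hz
    have h1 : IsUnit (algebraMap ℂ A (r / z) - a) := by
      by_contra h
      exact ha _ (spectrum.mem_iff.2 h) (by rw [norm_div, hz, div_one]; simp [hr.le])
    have h2 : (1 - z • ((r : ℂ)⁻¹ • a)) =
        algebraMap ℂ A (z / r) * (algebraMap ℂ A (r / z) - a) := by
      rw [mul_sub, ← map_mul, div_mul_div_cancel₀ hr0, div_self hz0, map_one,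
        ← Algebra.smul_def, smul_smul, div_eq_mul_inv]
    rw [h2]
    exact ((isUnit_iff_ne_zero.2 (div_ne_zero hz0 hr0)).map (algebraMap ℂ A)).mul h1
  obtain ⟨e, hee, hbe, hu, hsp⟩ := exists_rieszIdempotent_unitCircle hb
  have hab : a = (r : ℂ) • ((r : ℂ)⁻¹ • a) := by rw [smul_smul, mul_inv_cancel₀ hr0, one_smul]
  have hae : Commute a e := by rw [hab]; exact hbe.smul_left _
  refine ⟨e, hee, hae, ?_, fun z hz => ⟨?_, ?_⟩⟩
  · have hfe : (1 - e) * e = 0 := by rw [sub_mul, hee, one_mul, sub_self]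
    have hef : e * (1 - e) = 0 := by rw [mul_sub, hee, mul_one, sub_self]
    have hf : (1 - e) * (1 - e) = 1 - e := by rw [mul_sub, mul_one, hfe, sub_zero]
    have hscal := isUnit_mul_add_mul hee ((isUnit_iff_ne_zero.2 hr0).map (algebraMap ℂ A))
      isUnit_one (Algebra.commutes _ _) (Commute.one_left e)
    have : a * (1 - e) + e = ((r : ℂ)⁻¹ • a * (1 - e) + e) *
        (algebraMap ℂ A r * (1 - e) + 1 * e) := by
      rw [← Algebra.smul_def, one_mul, add_mul, mul_add, mul_add, mul_smul_comm, mul_smul_comm,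
        mul_assoc, hf, mul_assoc, hfe, hef, hee, mul_zero, smul_zero, add_zero, zero_add,
        ← smul_mul_assoc, ← hab]
    rw [this]
    exact hu.mul hscal
  · have h1 : z / r ∈ spectrum ℂ ((r : ℂ)⁻¹ • a * e) := by
      rw [spectrum.mem_iff] at hz ⊢
      refine fun h => hz ?_
      have h2 : algebraMap ℂ A z - a * e =
          algebraMap ℂ A r * (algebraMap ℂ A (z / r) - (r : ℂ)⁻¹ • a * e) := by
        rw [mul_sub, ← map_mul, mul_div_cancel₀ z hr0, ← Algebra.smul_def, ← smul_mul_assoc, ← hab]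
      rw [h2]
      exact ((isUnit_iff_ne_zero.2 hr0).map (algebraMap ℂ A)).mul h
    have := hsp _ h1
    rwa [norm_div, Complex.norm_of_nonneg hr.le, div_le_one hr] at this
  · by_contra! h
    refine spectrum.mem_iff.1 hz ?_
    -- A nonzero `z` outside the spectrum of `a` makes `z - a * e = z * (1 - e) + (z - a) * e` a
    -- glued unit.
    have key := isUnit_mul_add_mul hee ((isUnit_iff_ne_zero.2 h.1).map (algebraMap ℂ A))
      (spectrum.notMem_iff.1 h.2) (Algebra.commutes _ _)
      ((show Commute (algebraMap ℂ A z) e from Algebra.commutes _ _).sub_left hae)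
    convert key using 1
    noncomm_ring

end RieszIdempotent

/-! ### The residue ideals, retracts and direct sums -/

section Residue

variable {X : Type u} [NormedAddCommGroup X] [NormedSpace ℂ X]
variable {Y : Type v} [NormedAddCommGroup Y] [NormedSpace ℂ Y]

/-- The two-sided ideal of operators of finite rank. -/
def finiteRankIdeal (X : Type u) [NormedAddCommGroup X] [NormedSpace ℂ X] :
    TwoSidedIdeal (X →L[ℂ] X) :=
  TwoSidedIdeal.mk' {x | x.toLinearMap.HasFiniteRange} LinearMap.HasFiniteRange.zero
    (fun hx hy => LinearMap.HasFiniteRange.add hx hy) (fun hx => LinearMap.HasFiniteRange.neg hx)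
    (fun hy => LinearMap.HasFiniteRange.comp_left hy _)
    (fun hx => LinearMap.HasFiniteRange.comp_right hx _)

lemma mem_finiteRankIdeal {x : X →L[ℂ] X} :
    x ∈ finiteRankIdeal X ↔ x.toLinearMap.HasFiniteRange :=
  TwoSidedIdeal.mem_mk' ..

/-- The ideal in which the spectral idempotent at a point outside `σ_*` lies. -/
def residueIdeal (s : SpectrumKind) (X : Type u) [NormedAddCommGroup X] [NormedSpace ℂ X] :
    TwoSidedIdeal (X →L[ℂ] X) :=
  match s with
  | .full => ⊥
  | .browder => finiteRankIdeal X
  | .drazin => ⊤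

lemma residueIdeal_comp {s : SpectrumKind} {x : X →L[ℂ] X} (hx : x ∈ residueIdeal s X)
    (P : X →L[ℂ] Y) (Q : Y →L[ℂ] X) : P ∘L x ∘L Q ∈ residueIdeal s Y := by
  cases s with
  | full =>
    rw [show x = 0 from (TwoSidedIdeal.mem_bot _).1 hx]
    simp [residueIdeal]
  | browder =>
    have h := mem_finiteRankIdeal.1 hx
    exact mem_finiteRankIdeal.2
      (LinearMap.HasFiniteRange.comp_left (LinearMap.HasFiniteRange.comp_right h _) _)
  | drazin => trivial

/-- Regularity passes to a retract. -/
lemma RegularMod.of_retract {s : SpectrumKind} {T : X →L[ℂ] X} {S : Y →L[ℂ] Y}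
    (h : RegularMod (residueIdeal s X) T) (P : X →L[ℂ] Y) (Q : Y →L[ℂ] X)
    (hPQ : P ∘L Q = 1) (hP : P ∘L T = S ∘L P) (hQ : T ∘L Q = Q ∘L S) :
    RegularMod (residueIdeal s Y) S := by
  obtain ⟨U, hTU, ⟨n, hn⟩, hJ⟩ := h
  have e1 : S * (P ∘L U ∘L Q) = P ∘L (T * U) ∘L Q := by
    calc S * (P ∘L U ∘L Q) = (S ∘L P) ∘L U ∘L Q := rfl
      _ = _ := by rw [← hP]; rfl
  have e2 : (P ∘L U ∘L Q) * S = P ∘L (T * U) ∘L Q := by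
    calc (P ∘L U ∘L Q) * S = P ∘L U ∘L (Q ∘L S) := rfl
      _ = P ∘L (U * T) ∘L Q := by rw [← hQ]; rfl
      _ = _ := by rw [hTU.eq]
  have e3 : 1 - S * (P ∘L U ∘L Q) = P ∘L (1 - T * U) ∘L Q := by
    rw [e1, ContinuousLinearMap.sub_comp, ContinuousLinearMap.comp_sub, ← hPQ]; rfl
  have e4 : ∀ k : ℕ, (S ^ k) ∘L P = P ∘L (T ^ k) := by
    intro k
    induction k with
    | zero => rfl
    | succ k ih =>
      calc (S ^ (k + 1)) ∘L P = (S ^ k) ∘L (S ∘L P) := by rw [pow_succ]; rfl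
        _ = ((S ^ k) ∘L P) ∘L T := by rw [← hP]; rfl
        _ = _ := by rw [ih, pow_succ]; rfl
  refine ⟨P ∘L U ∘L Q, e1.trans e2.symm, ⟨n, ?_⟩, ?_⟩
  · rw [e3]
    calc S ^ n * (P ∘L (1 - T * U) ∘L Q) = ((S ^ n) ∘L P) ∘L (1 - T * U) ∘L Q := rfl
      _ = P ∘L (T ^ n * (1 - T * U)) ∘L Q := by rw [e4]; rfl
      _ = 0 := by rw [hn]; simp
  · rw [e3]; exact residueIdeal_comp hJ P Q

lemma regularMod_prodMap_iff {s : SpectrumKind} {S : Y →L[ℂ] Y} {T : X →L[ℂ] X} :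
    RegularMod (residueIdeal s (Y × X)) (S.prodMap T) ↔
      RegularMod (residueIdeal s Y) S ∧ RegularMod (residueIdeal s X) T := by
  constructor
  · intro h
    exact ⟨h.of_retract (.fst ℂ Y X) (.inl ℂ Y X) (by ext; rfl) (by ext <;> simp)
        (by ext <;> simp),
      h.of_retract (.snd ℂ Y X) (.inr ℂ Y X) (by ext; rfl) (by ext <;> simp) (by ext <;> simp)⟩
  · rintro ⟨⟨U, hU, ⟨n, hn⟩, hUJ⟩, V, hV, ⟨m, hm⟩, hVJ⟩
    have hmul : ∀ (a b : Y →L[ℂ] Y) (c d : X →L[ℂ] X),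
        a.prodMap c * b.prodMap d = (a * b).prodMap (c * d) := fun _ _ _ _ => rfl
    have hpow : ∀ k : ℕ, S.prodMap T ^ k = (S ^ k).prodMap (T ^ k) := by
      intro k
      induction k with
      | zero => ext <;> rfl
      | succ k ih => rw [pow_succ, ih, hmul, pow_succ, pow_succ]
    have h1 : (1 : (Y × X) →L[ℂ] (Y × X)) - S.prodMap T * U.prodMap V =
        (1 - S * U).prodMap (1 - T * V) := by ext <;> simp
    refine ⟨U.prodMap V, ?_, ⟨max n m, ?_⟩, ?_⟩
    · rw [Commute, SemiconjBy, hmul, hmul, hU.eq, hV.eq]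
    · rw [h1, hpow, hmul, pow_mul_eq_zero_of_le hn (le_max_left n m),
        pow_mul_eq_zero_of_le hm (le_max_right n m)]
      ext <;> rfl
    · have h2 : (1 : (Y × X) →L[ℂ] (Y × X)) - S.prodMap T * U.prodMap V =
          .inl ℂ Y X ∘L (1 - S * U) ∘L .fst ℂ Y X + .inr ℂ Y X ∘L (1 - T * V) ∘L .snd ℂ Y X := by
        ext <;> simp
      rw [h2]
      exact (residueIdeal s _).add_mem (residueIdeal_comp hUJ _ _) (residueIdeal_comp hVJ _ _)

end Residue

/-! ### Browder and Drazin invertibility as regularity modulo an ideal -/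

section Browder

variable {X : Type u} [NormedAddCommGroup X] [NormedSpace ℂ X]

lemma isFredholm_of_regularMod [CompleteSpace X] {T : X →L[ℂ] X}
    (h : RegularMod (finiteRankIdeal X) T) : T.IsFredholm := by
  obtain ⟨S, hTS, -, hJ⟩ := h
  have hJ' := mem_finiteRankIdeal.1 hJ
  refine ContinuousLinearMap.IsFredholm.of_isQuasiInverse (v := S) ⟨?_, ?_⟩
  · refine LinearMap.FiniteRangeSetoid.equiv_iff_hasFiniteRange.2 ?_
    have h1 : S.toLinearMap ∘ₗ T.toLinearMap - .id = -(1 - T * S).toLinearMap := by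
      rw [hTS.eq]; ext x; simp
    rw [h1]
    exact hJ'.neg
  · refine LinearMap.FiniteRangeSetoid.equiv_iff_hasFiniteRange.2 ?_
    have h1 : T.toLinearMap ∘ₗ S.toLinearMap - .id = -(1 - T * S).toLinearMap := by
      ext x; simp
    rw [h1]
    exact hJ'.neg

lemma hasFiniteAscent_of_regularMod {J : TwoSidedIdeal (X →L[ℂ] X)} {T : X →L[ℂ] X}
    (h : RegularMod J T) : HasFiniteAscent T ∧ HasFiniteDescent T := by
  obtain ⟨S, hTS, ⟨n, hn⟩, -⟩ := h
  have h1 : T ^ n = T ^ (n + 1) * S := by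
    rw [mul_sub, mul_one, ← mul_assoc, ← pow_succ] at hn
    exact sub_eq_zero.1 hn
  have h2 : T ^ n = S * T ^ (n + 1) := by rw [h1, (hTS.pow_left _).eq]
  refine ⟨⟨n, le_antisymm (fun x hx => ?_) (fun x hx => ?_)⟩,
    n, le_antisymm ?_ ?_⟩
  · have hx' : (T ^ n) x = 0 := hx
    change (T ^ (n + 1)) x = 0
    rw [pow_succ', mul_apply_eq_comp, hx', map_zero]
  · have hx' : (T ^ (n + 1)) x = 0 := hx
    change (T ^ n) x = 0
    rw [h2, mul_apply_eq_comp, hx', map_zero]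
  · rintro _ ⟨x, rfl⟩
    exact ⟨S x, (congrArg (fun f : X →L[ℂ] X => f x) h1).symm⟩
  · rintro _ ⟨x, rfl⟩
    exact ⟨T x, by rw [pow_succ]; rfl⟩

lemma ker_pow_eq_of_le {T : X →L[ℂ] X} {n : ℕ} (h : (T ^ n).ker = (T ^ (n + 1)).ker)
    {k : ℕ} (hk : n ≤ k) : (T ^ k).ker = (T ^ n).ker := by
  induction k, hk using Nat.le_induction with
  | base => rfl
  | succ k hk ih =>
    rw [← ih]
    refine le_antisymm (fun x hx => ?_) (fun x hx => ?_)
    · have hx' : (T ^ (k + 1)) x = 0 := hx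
      have hTx : T x ∈ (T ^ k).ker := by
        change (T ^ k) (T x) = 0
        rwa [pow_succ, mul_apply_eq_comp] at hx'
      rw [ih] at hTx ⊢
      rw [h]
      change (T ^ (n + 1)) x = 0
      rw [pow_succ]
      exact hTx
    · have hx' : (T ^ k) x = 0 := hx
      change (T ^ (k + 1)) x = 0
      rw [pow_succ', mul_apply_eq_comp, hx', map_zero]

lemma range_pow_eq_of_le {T : X →L[ℂ] X} {n : ℕ} (h : (T ^ n).range = (T ^ (n + 1)).range)
    {k : ℕ} (hk : n ≤ k) : (T ^ k).range = (T ^ n).range := by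
  induction k, hk using Nat.le_induction with
  | base => rfl
  | succ k hk ih =>
    refine le_antisymm ?_ ?_
    · rw [← ih]
      rintro _ ⟨x, rfl⟩
      exact ⟨T x, by rw [pow_succ]; rfl⟩
    · rw [h]
      rintro _ ⟨x, rfl⟩
      obtain ⟨y, hy⟩ : (T ^ n) x ∈ (T ^ k).range := by rw [ih]; exact ⟨x, rfl⟩
      have hy' : (T ^ k) y = (T ^ n) x := hy
      refine ⟨y, ?_⟩
      change (T ^ (k + 1)) y = (T ^ (n + 1)) x
      rw [pow_succ', pow_succ', mul_apply_eq_comp, mul_apply_eq_comp, hy']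

lemma isFredholm_pow [CompleteSpace X] {T : X →L[ℂ] X} (h : T.IsFredholm) (n : ℕ) :
    (T ^ n).IsFredholm := by
  obtain ⟨v, hv⟩ := h.exists_isQuasiInverse
  refine ContinuousLinearMap.IsFredholm.of_isQuasiInverse (v := v ^ n) ?_
  induction n with
  | zero =>
    exact LinearEquiv.isQuasiInverse (LinearEquiv.refl ℂ X)
  | succ n ih =>
    have := hv.comp ih
    rw [pow_succ' v, pow_succ T]
    exact this

/-- For a high power `U = T ^ N` the kernel and range are closed complements. With `e` the
finite-rank projection onto the kernel along the range, `U + e` is bijective, and `(U + e)⁻¹ * (1 -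
e)` inverts `U` up to `e`. -/
lemma IsBrowder.regularMod [CompleteSpace X] {T : X →L[ℂ] X} (h : IsBrowder T) :
    RegularMod (finiteRankIdeal X) T := by
  obtain ⟨hF, ⟨n, hn⟩, m, hm⟩ := h
  -- The extra `1` makes `N` nonzero, as passing from `T ^ N` back to `T` requires.
  set N := max n m + 1 with hN
  set U := T ^ N with hU
  have hker : (U * U).ker = U.ker := by
    rw [hU, ← pow_add, ker_pow_eq_of_le hn (by lia : n ≤ N + N),
      ker_pow_eq_of_le hn (by lia : n ≤ N)]
  have hran : (U * U).range = U.range := by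
    rw [hU, ← pow_add, range_pow_eq_of_le hm (by lia : m ≤ N + N),
      range_pow_eq_of_le hm (by lia : m ≤ N)]
  have hUF : U.IsFredholm := isFredholm_pow hF N
  have hkU : ∀ x, U (U x) = 0 → U x = 0 := fun x hx => by
    have : x ∈ (U * U).ker := hx
    rw [hker] at this
    exact this
  have hcompl : IsCompl U.ker U.range := by
    constructor
    · rw [Submodule.disjoint_def]
      rintro _ hx ⟨w, rfl⟩
      exact hkU w hx
    · rw [codisjoint_iff, eq_top_iff]
      intro x _
      obtain ⟨w, hw⟩ : U x ∈ (U * U).range := by rw [hran]; exact ⟨x, rfl⟩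
      have hw' : U (U w) = U x := hw
      rw [Submodule.mem_sup]
      exact ⟨x - U w, show U (x - U w) = 0 by rw [map_sub, hw', sub_self], U w, ⟨w, rfl⟩, by simp⟩
  have hclosed : IsClosed (U.ker : Set X) := U.isClosed_ker
  have htop := Submodule.IsCompl.isTopCompl_of_isClosed hcompl hclosed hUF.isClosed_range
  set e : X →L[ℂ] X := U.ker.projectionL U.range htop with he
  have heK : ∀ x ∈ U.ker, e x = x := fun x hx => Submodule.projectionL_apply_left htop ⟨x, hx⟩
  have heR : ∀ x ∈ U.range, e x = 0 := fun x hx => Submodule.projectionL_apply_right htop ⟨x, hx⟩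
  have heK' : ∀ x, e x ∈ U.ker := fun x => Submodule.projectionL_apply_mem htop x
  have hUe : U * e = 0 := by ext x; exact heK' x
  have heU' : ∀ x, e (U x) = 0 := fun x => heR _ ⟨x, rfl⟩
  have heU : e * U = 0 := by ext x; exact heU' x
  have hee : e * e = e := by ext x; exact heK _ (heK' x)
  have hbij : Function.Bijective (U + e) := by
    constructor
    · rw [← ContinuousLinearMap.coe_coe, ← LinearMap.ker_eq_bot, eq_bot_iff]
      intro x hx
      have hx' : U x + e x = 0 := hx
      have h1 : e x = 0 := by
        have := congrArg e hx'
        rw [map_add, map_zero, heU', zero_add, heK _ (heK' x)] at this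
        exact this
      have h2 : U x = 0 := by rwa [h1, add_zero] at hx'
      rw [heK x h2] at h1
      exact h1
    · intro y
      have hy : y ∈ U.ker ⊔ U.range := hcompl.sup_eq_top ▸ Submodule.mem_top
      obtain ⟨k, hk, _, ⟨w, rfl⟩, rfl⟩ := Submodule.mem_sup.1 hy
      obtain ⟨w', hw'⟩ : U w ∈ (U * U).range := by rw [hran]; exact ⟨w, rfl⟩
      have hw'' : U (U w') = U w := hw'
      have hk0 : U k = 0 := hk
      refine ⟨k + U w', ?_⟩
      change U (k + U w') + e (k + U w') = k + U w
      rw [map_add, map_add, hk0, hw'', heK k hk, heU', zero_add, add_zero, add_comm]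
  obtain ⟨W, hW⟩ := ContinuousLinearMap.isUnit_iff_bijective.2 hbij
  have hUW : Commute U W := by
    rw [hW]
    exact (Commute.refl U).add_right (show U * e = e * U by rw [hUe, heU])
  have hUc : Commute U (1 - e) :=
    (Commute.one_right U).sub_right (show U * e = e * U by rw [hUe, heU])
  have hkey : U * (↑W⁻¹ * (1 - e)) = 1 - e := by
    have : U * (1 - e) = W * (1 - e) := by
      rw [hW, add_mul, mul_sub e, hee, mul_one, sub_self, add_zero]
    rw [← mul_assoc, (hUW.units_inv_right).eq, mul_assoc, this, ← mul_assoc, W.inv_mul, one_mul]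
  have hreg : RegularMod (finiteRankIdeal X) (T ^ N) := by
    refine ⟨↑W⁻¹ * (1 - e), hUW.units_inv_right.mul_right hUc, ⟨1, ?_⟩, ?_⟩
    · rw [← hU, hkey, sub_sub_cancel, pow_one, hUe]
    · rw [← hU, hkey, sub_sub_cancel, mem_finiteRankIdeal, LinearMap.hasFiniteRange_iff_range]
      have := hUF.finite_ker
      have hr : e.toLinearMap.range = U.ker := Submodule.range_projectionL htop
      rw [hr]
      exact Submodule.FG.of_finite
  exact hreg.of_pow (by lia)

lemma isBrowder_iff_regularMod [CompleteSpace X] {T : X →L[ℂ] X} :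
    IsBrowder T ↔ RegularMod (finiteRankIdeal X) T :=
  ⟨IsBrowder.regularMod, fun h => ⟨isFredholm_of_regularMod h, hasFiniteAscent_of_regularMod h⟩⟩

lemma isDrazinInvertible_iff_regularMod {T : X →L[ℂ] X} :
    IsDrazinInvertible T ↔ RegularMod ⊤ T := by
  have h : ∀ (S : X →L[ℂ] X) (n : ℕ), T ^ n * (1 - T * S) = 0 ↔ T ^ (n + 1) * S = T ^ n := by
    intro S n
    rw [mul_sub, mul_one, ← mul_assoc, ← pow_succ, sub_eq_zero, eq_comm]
  constructor
  · rintro ⟨S, hS, -, n, hn⟩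
    exact ⟨S, hS, ⟨n, (h S n).2 hn⟩, trivial⟩
  · intro hT
    obtain ⟨S, hS, hSTS, ⟨n, hn⟩, -⟩ := hT.exists_drazinInverse
    exact ⟨S, hS, hSTS, n, (h S n).1 hn⟩

end Browder

/-! ### Compactness and functoriality of `σ_*` -/

section SigmaStar

variable {X : Type u} [NormedAddCommGroup X] [NormedSpace ℂ X]
variable {Y : Type v} [NormedAddCommGroup Y] [NormedSpace ℂ Y]

lemma mem_sigmaStar_iff [CompleteSpace X] {s : SpectrumKind} {T : X →L[ℂ] X} {z : ℂ} :
    z ∈ sigmaStar s T ↔ ¬ RegularMod (residueIdeal s X) (T - algebraMap ℂ (X →L[ℂ] X) z) := by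
  cases s with
  | full =>
    change z ∈ spectrum ℂ T ↔ ¬ RegularMod ⊥ _
    rw [regularMod_bot_iff, spectrum.mem_iff, ← IsUnit.neg_iff, neg_sub]
  | browder =>
    rw [Algebra.algebraMap_eq_smul_one]
    exact not_congr isBrowder_iff_regularMod
  | drazin =>
    rw [Algebra.algebraMap_eq_smul_one]
    exact not_congr isDrazinInvertible_iff_regularMod

lemma sigmaStar_subset_spectrum [CompleteSpace X] (s : SpectrumKind) (T : X →L[ℂ] X) :
    sigmaStar s T ⊆ spectrum ℂ T := by
  intro z hz
  change z ∈ sigmaStar .full T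
  rw [mem_sigmaStar_iff] at hz ⊢
  exact fun h => hz (h.mono bot_le)

lemma eventually_notMem_spectrum [CompleteSpace X] {s : SpectrumKind} {T : X →L[ℂ] X} {z : ℂ}
    (hz : z ∉ sigmaStar s T) : ∀ᶠ y in 𝓝[≠] z, y ∉ spectrum ℂ T := by
  rw [mem_sigmaStar_iff, not_not] at hz
  have h := hz.eventually_isUnit
  have ht : Tendsto (fun y : ℂ => y - z) (𝓝[≠] z) (𝓝[≠] 0) := by
    refine tendsto_nhdsWithin_iff.2 ⟨?_, ?_⟩
    · have : Tendsto (fun y : ℂ => y - z) (𝓝 z) (𝓝 (z - z)) :=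
        (continuous_sub_right z).continuousAt
      rw [sub_self] at this
      exact this.mono_left nhdsWithin_le_nhds
    · filter_upwards [self_mem_nhdsWithin] with y hy
      exact sub_ne_zero.2 hy
  filter_upwards [ht.eventually h] with y hy
  rw [spectrum.notMem_iff, ← IsUnit.neg_iff, neg_sub]
  convert hy using 1
  rw [map_sub]; abel

/-- A point outside `σ_*(T)` has a punctured neighbourhood free of `σ(T)`, hence of `σ_*(T)`, so
`σ_*(T)` is closed. -/
lemma isCompact_sigmaStar [CompleteSpace X] (s : SpectrumKind) (T : X →L[ℂ] X) :
    IsCompact (sigmaStar s T) := by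
  refine (spectrum.isCompact T).of_isClosed_subset ?_ (sigmaStar_subset_spectrum s T)
  rw [isClosed_iff_derivedSet_subset]
  intro z hz
  by_contra hcon
  rw [mem_derivedSet, accPt_iff_frequently_nhdsNE] at hz
  exact hz ((eventually_notMem_spectrum hcon).mono fun y hy h =>
    hy (sigmaStar_subset_spectrum s T h))

lemma sigmaStar_pow [CompleteSpace X] (s : SpectrumKind) (T : X →L[ℂ] X) {m : ℕ} (hm : m ≠ 0) :
    sigmaStar s (T ^ m) = (fun z => z ^ m) '' sigmaStar s T := by
  ext w
  rw [mem_sigmaStar_iff, regularMod_pow_sub_iff hm]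
  push Not
  simp only [mem_image, mem_sigmaStar_iff, and_comm]

lemma prodMap_sub_algebraMap (S : Y →L[ℂ] Y) (T : X →L[ℂ] X) (z : ℂ) :
    S.prodMap T - algebraMap ℂ _ z =
      (S - algebraMap ℂ _ z).prodMap (T - algebraMap ℂ _ z) := by
  ext <;> simp [Algebra.algebraMap_eq_smul_one]

lemma sigmaStar_prodMap [CompleteSpace X] [CompleteSpace Y] (s : SpectrumKind) (S : Y →L[ℂ] Y)
    (T : X →L[ℂ] X) : sigmaStar s (S.prodMap T) = sigmaStar s S ∪ sigmaStar s T := by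
  ext z
  rw [mem_union, mem_sigmaStar_iff, mem_sigmaStar_iff, mem_sigmaStar_iff, prodMap_sub_algebraMap,
    regularMod_prodMap_iff, not_and_or]

lemma sigmaStar_subset_of_retract [CompleteSpace X] [CompleteSpace Y] (s : SpectrumKind)
    {T : X →L[ℂ] X} {S : Y →L[ℂ] Y} (P : X →L[ℂ] Y) (Q : Y →L[ℂ] X)
    (hPQ : P ∘L Q = 1) (hP : P ∘L T = S ∘L P) (hQ : T ∘L Q = Q ∘L S) :
    sigmaStar s S ⊆ sigmaStar s T := by
  intro z
  rw [mem_sigmaStar_iff, mem_sigmaStar_iff]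
  refine mt fun h => h.of_retract P Q hPQ ?_ ?_
  · rw [ContinuousLinearMap.comp_sub, ContinuousLinearMap.sub_comp, hP]
    congr 1; ext; simp [Algebra.algebraMap_eq_smul_one]
  · rw [ContinuousLinearMap.comp_sub, ContinuousLinearMap.sub_comp, hQ]
    congr 1; ext; simp [Algebra.algebraMap_eq_smul_one]

end SigmaStar

/-! ### Generalized invertibility means `0 ∉ acc^α σ_*(T)` -/

section Characterization

variable {X : Type u} [NormedAddCommGroup X] [NormedSpace ℂ X] [CompleteSpace X]

lemma IsRed.isTopCompl {T : X →L[ℂ] X} {M N : Submodule ℂ X} (h : IsRed T M N) :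
    Submodule.IsTopCompl M N :=
  Submodule.IsCompl.isTopCompl_of_isClosed h.isCompl h.isClosed_left h.isClosed_right

lemma IsRed.sigmaStar_eq_union {T : X →L[ℂ] X} {M N : Submodule ℂ X} (h : IsRed T M N)
    (s : SpectrumKind) :
    sigmaStar s T = sigmaStar s (T.restrict h.invariant_left) ∪
      sigmaStar s (T.restrict h.invariant_right) := by
  have := h.isClosed_left.completeSpace_coe
  have := h.isClosed_right.completeSpace_coe
  set L : (M × N) ≃L[ℂ] X := M.prodEquivOfIsTopCompl N h.isTopCompl
  have hL : ∀ x, L x = x.1 + x.2 := fun x => rfl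
  have hTL : T ∘L (L : (M × N) →L[ℂ] X) = (L : (M × N) →L[ℂ] X) ∘L
      (T.restrict h.invariant_left).prodMap (T.restrict h.invariant_right) := by
    ext x
    · simp [hL]
    · simp [hL]
  have hLT : (L.symm : X →L[ℂ] (M × N)) ∘L T =
      (T.restrict h.invariant_left).prodMap (T.restrict h.invariant_right) ∘L
        (L.symm : X →L[ℂ] (M × N)) := by
    ext1 x
    obtain ⟨y, rfl⟩ := L.surjective x
    have := congrArg (fun f => L.symm (f y)) hTL
    simpa using this
  rw [← sigmaStar_prodMap]
  refine Subset.antisymm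
    (sigmaStar_subset_of_retract s (L : (M × N) →L[ℂ] X) (L.symm : X →L[ℂ] (M × N))
      (by ext; simp) hTL.symm hLT.symm)
    (sigmaStar_subset_of_retract s (L.symm : X →L[ℂ] (M × N)) (L : (M × N) →L[ℂ] X)
      (ContinuousLinearMap.ext fun x => L.symm_apply_apply x) hLT hTL)

omit [CompleteSpace X] in
/-- The pair of subspaces given by a commuting idempotent. -/
lemma isRed_of_idempotent {T e : X →L[ℂ] X} (he : e * e = e) (hTe : Commute T e) :
    IsRed T e.ker (1 - e).ker where
  isClosed_left := e.isClosed_ker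
  isClosed_right := (1 - e).isClosed_ker
  invariant_left x hx := by
    have hx' : e x = 0 := hx
    have := congrArg (fun f : X →L[ℂ] X => f x) hTe.eq
    simp only [mul_apply_eq_comp, hx', map_zero] at this
    exact this.symm
  invariant_right x hx := by
    have hx' : x - e x = 0 := hx
    have := congrArg (fun f : X →L[ℂ] X => f x) hTe.eq
    simp only [mul_apply_eq_comp, ← sub_eq_zero.1 hx'] at this
    exact sub_eq_zero.2 this
  isCompl := by
    constructor
    · rw [Submodule.disjoint_def]
      intro x hx hx2
      have hx' : e x = 0 := hx
      have hx2' : x - e x = 0 := hx2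
      rwa [hx', sub_zero] at hx2'
    · rw [codisjoint_iff, eq_top_iff]
      intro x _
      have h2 : e (e x) = e x := congrArg (fun f : X →L[ℂ] X => f x) he
      exact Submodule.mem_sup.2 ⟨x - e x, show e (x - e x) = 0 by rw [map_sub, h2, sub_self],
        e x, show e x - e (e x) = 0 by rw [h2, sub_self], by abel⟩

omit [CompleteSpace X] in
lemma isUnit_restrict_of_idempotent {T e : X →L[ℂ] X} (he : e * e = e) (hTe : Commute T e)
    (hu : IsUnit (T * (1 - e) + e)) :
    IsUnit (T.restrict (isRed_of_idempotent he hTe).invariant_left) := by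
  have h2 : ∀ x, e (e x) = e x := fun x => congrArg (fun f : X →L[ℂ] X => f x) he
  have h3 : ∀ x, e (T x) = T (e x) := fun x =>
    (congrArg (fun f : X →L[ℂ] X => f x) hTe.eq).symm
  have hmem : ∀ x, (1 - e) x ∈ e.ker := fun x => by
    change e (x - e x) = 0
    rw [map_sub, h2, sub_self]
  have h0 : ∀ x : e.ker, e x = 0 := fun x => x.2
  -- The restriction to the kernel of `e` is a retract of `T * (1 - e) + e`, which agrees with `T`
  -- there.
  refine regularMod_bot_iff.1 (RegularMod.of_retract (s := .full) (regularMod_bot_iff.2 hu)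
    ((1 - e).codRestrict _ hmem) (Submodule.subtypeL _) ?_ ?_ ?_)
  · ext x; simp [h0]
  · ext x; simp [h2, h3]
  · ext x; simp [h0]

lemma spectrum_restrict_subset_of_idempotent {T e : X →L[ℂ] X} (he : e * e = e)
    (hTe : Commute T e) :
    spectrum ℂ (T.restrict (isRed_of_idempotent he hTe).invariant_right) ⊆
      spectrum ℂ (T * e) := by
  have := (isRed_of_idempotent he hTe).isClosed_right.completeSpace_coe
  have h2 : ∀ x, e (e x) = e x := fun x => congrArg (fun f : X →L[ℂ] X => f x) he
  have h3 : ∀ x, e (T x) = T (e x) := fun x =>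
    (congrArg (fun f : X →L[ℂ] X => f x) hTe.eq).symm
  have hmem : ∀ x, e x ∈ (1 - e).ker := fun x => by
    change e x - e (e x) = 0
    rw [h2, sub_self]
  have h0 : ∀ x : (1 - e).ker, e x = x := fun x => (sub_eq_zero.1 x.2).symm
  refine sigmaStar_subset_of_retract .full (e.codRestrict _ hmem) (Submodule.subtypeL _)
    (ContinuousLinearMap.ext fun x => Subtype.ext (h0 x))
    (ContinuousLinearMap.ext fun x => Subtype.ext ?_) (ContinuousLinearMap.ext fun x => ?_)
  · change e (T (e x)) = T (e x)
    rw [h3, h2]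
  · exact congrArg T (h0 x)

lemma exists_radius_avoiding {C : Set ℂ} (hC : C.Countable) {ρ : ℝ} (hρ : 0 < ρ) :
    ∃ r, 0 < r ∧ r < ρ ∧ ∀ z ∈ C, ‖z‖ ≠ r := by
  obtain ⟨r, ⟨h1, h2⟩, hr⟩ := ((hC.image norm).dense_compl ℝ).inter_open_nonempty _
    isOpen_Ioo (nonempty_Ioo.2 hρ)
  exact ⟨r, h1, h2, fun z hz h => hr ⟨z, hz, h⟩⟩

/-- Forward, `σ_*` splits as a union: the invertible part omits `0`, and `{0}` has no accumulation
points. Backward, a Riesz idempotent for a small circle avoiding the spectrum gives the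
decomposition. -/
lemma isGInvertibleSucc_iff (s : SpectrumKind) (β : Ordinal.{w}) (T : X →L[ℂ] X) :
    IsGInvertibleSucc s β T ↔ (0 : ℂ) ∉ accIter (sigmaStar s T) (β + 1) := by
  have hcl := (isCompact_sigmaStar s T).isClosed
  constructor
  · rintro ⟨M, N, h, hM, hN⟩
    have := h.isClosed_left.completeSpace_coe
    have := h.isClosed_right.completeSpace_coe
    have hMc := (isCompact_sigmaStar s (T.restrict h.invariant_left)).isClosed
    rw [h.sigmaStar_eq_union, accIter_union hMc (isCompact_sigmaStar s _).isClosed, mem_union,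
      not_or]
    constructor
    · intro h0
      have := sigmaStar_subset_spectrum s _ (accIter_subset hMc _ h0)
      rw [spectrum.mem_iff] at this
      exact this (by simpa using hM)
    · rw [accIter_add_one]
      intro h0
      have h1 := derivedSet_mono _ _ hN h0
      rw [mem_derivedSet, accPt_iff_nhds] at h1
      obtain ⟨y, hy, hy0⟩ := h1 univ univ_mem
      exact hy0 hy.2
  · intro h0
    rw [accIter_add_one, mem_derivedSet, accPt_iff_nhds] at h0
    push Not at h0
    obtain ⟨U, hU, hUB⟩ := h0
    obtain ⟨ρ, hρ, hρU⟩ := Metric.mem_nhds_iff.1 hU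
    have hB : ∀ z ∈ accIter (sigmaStar s T) β, ‖z‖ < ρ → z = 0 := fun z hz hzρ =>
      hUB z ⟨hρU (by simpa using hzρ), hz⟩
    set C := {z | z ∈ spectrum ℂ T ∧ ‖z‖ < ρ ∧ z ≠ 0} with hC
    have hCc : C.Countable := by
      -- A nonzero spectral point in the disc is either isolated in `σ(T)`, or in `σ_*(T)` but not
      -- in `acc^β σ_*(T)`.
      refine ((countable_diff_accIter (spectrum.isClosed T) (1 : Ordinal.{0})).union
        (countable_diff_accIter hcl β)).mono ?_
      rintro z ⟨hzT, hzρ, hz0⟩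
      by_cases hz : z ∈ sigmaStar s T
      · exact Or.inr ⟨hz, fun h => hz0 (hB z h hzρ)⟩
      · refine Or.inl ⟨hzT, fun h => ?_⟩
        rw [← zero_add (1 : Ordinal.{0}), accIter_add_one, accIter_zero, mem_derivedSet,
          accPt_iff_frequently_nhdsNE] at h
        exact h ((eventually_notMem_spectrum hz).mono fun y hy => by simpa using hy)
    obtain ⟨r, hr, hrρ, hrC⟩ := exists_radius_avoiding hCc hρ
    obtain ⟨e, he, hTe, hu, hsp⟩ := exists_rieszIdempotent T hr fun z hz hzr =>
      hrC z ⟨hz, hzr ▸ hrρ, by rintro rfl; rw [norm_zero] at hzr; exact hr.ne hzr⟩ hzr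
    have hred := isRed_of_idempotent he hTe
    have := hred.isClosed_right.completeSpace_coe
    refine ⟨_, _, hred, isUnit_restrict_of_idempotent he hTe hu, fun z hz => ?_⟩
    have hz1 := accIter_subset (isCompact_sigmaStar s _).isClosed _ hz
    have hz2 := hsp z (spectrum_restrict_subset_of_idempotent he hTe
      (sigmaStar_subset_spectrum s _ hz1))
    refine hB z (accIter_mono ?_ β hz) (hz2.1.trans_lt hrρ)
    rw [hred.sigmaStar_eq_union]
    exact subset_union_right

lemma isGInvertible_iff (s : SpectrumKind) (α : Ordinal.{w}) (T : X →L[ℂ] X) :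
    IsGInvertible s α T ↔ (0 : ℂ) ∉ accIter (sigmaStar s T) α := by
  rcases Ordinal.zero_or_succ_or_isSuccLimit α with rfl | ⟨β, rfl⟩ | hα
  · rw [accIter_zero, IsGInvertible, Ordinal.limitRecOn_zero]
  · rw [Order.succ_eq_add_one, IsGInvertible, Ordinal.limitRecOn_add_one,
      isGInvertibleSucc_iff]
  · rw [IsGInvertible, Ordinal.limitRecOn_limit _ _ _ _ hα, accIter_limit _ hα]
    simp only [mem_iInter, not_forall, isGInvertibleSucc_iff, exists_prop]
    constructor
    · rintro ⟨β, hβ, h⟩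
      exact ⟨β + 1, hβ, h⟩
    · rintro ⟨β, hβ, h⟩
      exact ⟨β, hα.add_one_lt hβ, fun h' => h
        (accIter_antitone (isCompact_sigmaStar s T).isClosed (le_add_of_nonneg_right zero_le) h')⟩

end Characterization

/-! ### Invariance of `σ_*` under the dual adjoint -/

section Dual

variable {X : Type u} [NormedAddCommGroup X] [NormedSpace ℂ X]

lemma dualAdjoint_apply (T : X →L[ℂ] X) (f : StrongDual ℂ X) (x : X) :
    dualAdjoint T f x = f (T x) := rfl

lemma dualAdjoint_mul (T S : X →L[ℂ] X) :
    dualAdjoint (T * S) = dualAdjoint S * dualAdjoint T := rfl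

lemma dualAdjoint_one : dualAdjoint (1 : X →L[ℂ] X) = 1 := rfl

lemma dualAdjoint_sub (T S : X →L[ℂ] X) :
    dualAdjoint (T - S) = dualAdjoint T - dualAdjoint S := by
  ext f x
  simp [dualAdjoint_apply]

lemma dualAdjoint_smul_one (z : ℂ) : dualAdjoint (z • (1 : X →L[ℂ] X)) = z • 1 := by
  ext f x
  change f (z • x) = z • f x
  rw [map_smul]

set_option synthInstance.maxHeartbeats 100000 in
lemma dualAdjoint_pow (T : X →L[ℂ] X) (n : ℕ) :
    dualAdjoint (T ^ n) = dualAdjoint T ^ n := by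
  induction n with
  | zero => rfl
  | succ n ih => rw [pow_succ, dualAdjoint_mul, ih, pow_succ']

lemma norm_dualAdjoint_le (T : X →L[ℂ] X) : ‖dualAdjoint T‖ ≤ ‖T‖ :=
  ContinuousLinearMap.opNorm_le_bound _ (norm_nonneg _) fun f => by
    rw [mul_comm]
    exact f.opNorm_comp_le T

lemma dualAdjoint_eq_zero_iff {T : X →L[ℂ] X} : dualAdjoint T = 0 ↔ T = 0 := by
  constructor
  · intro h
    ext x
    refine SeparatingDual.eq_zero_of_forall_dual_eq_zero (R := ℂ) fun f => ?_
    rw [← dualAdjoint_apply, h]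
    rfl
  · rintro rfl
    ext f x
    simp [dualAdjoint_apply]

lemma Commute.dualAdjoint {T S : X →L[ℂ] X} (h : Commute T S) :
    Commute (dualAdjoint T) (dualAdjoint S) := by
  rw [Commute, SemiconjBy, ← dualAdjoint_mul, ← dualAdjoint_mul, h.eq]

/-- An operator on a Banach space is invertible as soon as its dual adjoint is. -/
lemma isUnit_dualAdjoint_iff [CompleteSpace X] {T : X →L[ℂ] X} :
    IsUnit (dualAdjoint T) ↔ IsUnit T := by
  constructor
  · rintro ⟨V, hV⟩
    have hTV : ∀ f : StrongDual ℂ X, dualAdjoint T ((↑V⁻¹ : _ →L[ℂ] _) f) = f := fun f => by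
      rw [← hV, ← mul_apply_eq_comp, V.mul_inv]; rfl
    have hVT : ∀ f : StrongDual ℂ X, (↑V⁻¹ : _ →L[ℂ] _) (dualAdjoint T f) = f := fun f => by
      rw [← hV, ← mul_apply_eq_comp, V.inv_mul]; rfl
    set W : StrongDual ℂ X →L[ℂ] StrongDual ℂ X := ↑V⁻¹
    -- Norming functionals `f` give `‖x‖ = ‖(W f) (T x)‖ ≤ ‖W‖ ‖T x‖`, so `T` is bounded below and
    -- has closed range.
    have hanti : AntilipschitzWith ‖W‖₊ T := by
      refine AddMonoidHomClass.antilipschitz_of_bound T fun x => ?_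
      obtain ⟨f, hf, hfx⟩ := exists_dual_vector'' ℂ x
      have h1 : (W f) (T x) = ‖x‖ := by rw [← dualAdjoint_apply, hTV, hfx]; rfl
      have h2 : ‖x‖ = ‖(W f) (T x)‖ := by rw [h1]; simp
      rw [h2]
      calc ‖(W f) (T x)‖ ≤ ‖W f‖ * ‖T x‖ := (W f).le_opNorm _
        _ ≤ ‖W‖ * ‖T x‖ := by
          gcongr
          exact (W.le_opNorm f).trans (mul_le_of_le_one_right (norm_nonneg _) hf)
    have hclosed : IsClosed (T.range : Set X) := hanti.isClosed_range T.uniformContinuous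
    refine ContinuousLinearMap.isUnit_iff_bijective.2 ⟨hanti.injective, fun y => ?_⟩
    change y ∈ T.range
    rw [← Submodule.Quotient.mk_eq_zero]
    refine SeparatingDual.eq_zero_of_forall_dual_eq_zero (R := ℂ) fun f => ?_
    -- A functional on the quotient by the range pulls back into the kernel of the adjoint, hence
    -- vanishes; the closed range is therefore everything.
    have h1 : dualAdjoint T (f ∘L T.range.mkQL) = 0 := by
      ext x
      have : T.range.mkQL (T x) = 0 := (Submodule.Quotient.mk_eq_zero _).2 ⟨x, rfl⟩
      rw [dualAdjoint_apply, ContinuousLinearMap.comp_apply, this, map_zero]; rfl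
    have h2 := hVT (f ∘L T.range.mkQL)
    rw [h1, map_zero] at h2
    exact (congrArg (fun g : StrongDual ℂ X => g y) h2).symm
  · rintro ⟨V, rfl⟩
    exact ⟨⟨dualAdjoint V, dualAdjoint ↑V⁻¹, by rw [← dualAdjoint_mul, V.inv_mul, dualAdjoint_one],
      by rw [← dualAdjoint_mul, V.mul_inv, dualAdjoint_one]⟩, rfl⟩

lemma hasFiniteRange_dualAdjoint {x : X →L[ℂ] X} (hx : x.toLinearMap.HasFiniteRange) :
    (dualAdjoint x).toLinearMap.HasFiniteRange := by
  have : FiniteDimensional ℂ x.range := Module.Finite.iff_fg.2 hx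
  have hfac : (dualAdjoint x).toLinearMap =
      (ContinuousLinearMap.precomp ℂ x.rangeRestrict).toLinearMap ∘ₗ
        (ContinuousLinearMap.precomp ℂ x.range.subtypeL).toLinearMap := rfl
  rw [hfac]
  refine LinearMap.HasFiniteRange.comp_right ?_ _
  have : FiniteDimensional ℂ (x.range →L[ℂ] ℂ) := inferInstance
  exact LinearMap.HasFiniteRange.of_finite_dom

/-- For the descent, the double adjoint extends `x` along the injective embedding of `X` in its
bidual. -/
lemma hasFiniteRange_dualAdjoint_iff {x : X →L[ℂ] X} :
    (dualAdjoint x).toLinearMap.HasFiniteRange ↔ x.toLinearMap.HasFiniteRange := by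
  refine ⟨fun h => ?_, hasFiniteRange_dualAdjoint⟩
  have h2 := hasFiniteRange_dualAdjoint h
  set i := NormedSpace.inclusionInDoubleDual ℂ X
  have hi : Function.Injective i := (NormedSpace.inclusionInDoubleDualLi ℂ (E := X)).injective
  have hcomp : i.toLinearMap ∘ₗ x.toLinearMap =
      (dualAdjoint (dualAdjoint x)).toLinearMap ∘ₗ i.toLinearMap := rfl
  have h3 : (i.toLinearMap ∘ₗ x.toLinearMap).HasFiniteRange := by
    rw [hcomp]; exact LinearMap.HasFiniteRange.comp_right h2 _
  rw [LinearMap.HasFiniteRange, LinearMap.range_comp] at h3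
  exact Submodule.fg_of_fg_map_injective i.toLinearMap hi h3

lemma dualAdjoint_mem_residueIdeal_iff {s : SpectrumKind} {x : X →L[ℂ] X} :
    dualAdjoint x ∈ residueIdeal s (StrongDual ℂ X) ↔ x ∈ residueIdeal s X := by
  cases s with
  | full => exact dualAdjoint_eq_zero_iff
  | browder =>
    exact mem_finiteRankIdeal.trans (hasFiniteRange_dualAdjoint_iff.trans mem_finiteRankIdeal.symm)
  | drazin => exact Iff.rfl

lemma spectrum_dualAdjoint [CompleteSpace X] (T : X →L[ℂ] X) :
    spectrum ℂ (dualAdjoint T) = spectrum ℂ T := by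
  ext z
  rw [spectrum.mem_iff, spectrum.mem_iff, Algebra.algebraMap_eq_smul_one,
    Algebra.algebraMap_eq_smul_one, ← dualAdjoint_smul_one, ← dualAdjoint_sub,
    isUnit_dualAdjoint_iff]

/-- Powers of a quasinilpotent element decay faster than any geometric sequence. -/
lemma tendsto_norm_pow_mul_of_spectrum_subset {A : Type*} [NormedRing A] [NormedAlgebra ℂ A]
    [CompleteSpace A] {a : A} (ha : spectrum ℂ a ⊆ {0}) {C : ℝ} (hC : 0 ≤ C) :
    Tendsto (fun k : ℕ => ‖a ^ k‖ * C ^ k) atTop (𝓝 0) := by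
  have hr : spectralRadius ℂ a = 0 := by
    refine le_antisymm (iSup₂_le fun z hz => ?_) zero_le
    rw [show z = 0 from ha hz]; simp
  have h := spectrum.pow_norm_pow_one_div_tendsto_nhds_spectralRadius a
  rw [hr] at h
  -- Chosen so that `ε * C ≤ 1 / 2`.
  set ε : ℝ := 1 / (2 * (C + 1)) with hε
  have hε0 : 0 < ε := by positivity
  have hev := h.eventually_lt_const (ENNReal.ofReal_pos.2 hε0)
  refine squeeze_zero' (Eventually.of_forall fun k => by positivity) ?_
    (tendsto_pow_atTop_nhds_zero_of_lt_one (r := 1 / 2) (by norm_num) (by norm_num))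
  filter_upwards [hev, eventually_ge_atTop 1] with k hk hk1
  rw [ENNReal.ofReal_lt_ofReal_iff hε0] at hk
  have h1 : ‖a ^ k‖ ≤ ε ^ k := by
    calc ‖a ^ k‖ = (‖a ^ k‖ ^ (1 / k : ℝ)) ^ k := by
          rw [one_div, Real.rpow_inv_natCast_pow (norm_nonneg _) (by lia)]
      _ ≤ ε ^ k := by gcongr
  calc ‖a ^ k‖ * C ^ k ≤ ε ^ k * C ^ k := by gcongr
    _ = (ε * C) ^ k := (mul_pow _ _ _).symm
    _ ≤ (1 / 2) ^ k := by
      gcongr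
      rw [hε, div_mul_eq_mul_div, one_mul, div_le_div_iff₀ (by positivity) (by norm_num)]
      linarith

/-- The spectral idempotent of a regular element absorbs every commuting idempotent on which the
element is quasinilpotent. -/
lemma RegularMod.idempotent_mem {A : Type*} [NormedRing A] {J : TwoSidedIdeal A} {a e : A}
    (h : RegularMod J a) (he : e * e = e) (hae : Commute a e)
    (hlim : ∀ C : ℝ, 0 ≤ C → Tendsto (fun k : ℕ => ‖(a * e) ^ k‖ * C ^ k) atTop (𝓝 0)) :
    e ∈ J ∧ ∃ n, a ^ n * e = 0 := by
  obtain ⟨b, hab, hbab, ⟨n, hn⟩, hJ, hcomm⟩ := h.exists_drazinInverse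
  have hbe : Commute b e := hcomm e hae
  have hpp : a * b * (a * b) = a * b := by rw [mul_assoc, ← mul_assoc b, hbab]
  have hpe : Commute (a * b) e := hae.mul_left hbe
  have haeb : Commute (a * e) b := hab.mul_left hbe.symm
  have hg : a * e * b = a * b * e := by rw [mul_assoc, ← hbe.eq, mul_assoc]
  have hgid : IsIdempotentElem (a * e * b) := by
    rw [hg]
    calc a * b * e * (a * b * e) = a * b * (e * (a * b)) * e := by simp only [mul_assoc]
      _ = (a * b * (a * b)) * (e * e) := by rw [← hpe.eq]; simp only [mul_assoc]
      _ = _ := by rw [hpp, he]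
  -- An idempotent equals its powers, here bounded by `‖(a * e) ^ k‖ * ‖b‖ ^ k`, which tends to `0`.
  have hg0 : a * e * b = 0 := by
    rw [← norm_eq_zero]
    refine le_antisymm (ge_of_tendsto (hlim ‖b‖ (norm_nonneg b)) ?_) (norm_nonneg _)
    filter_upwards [eventually_ge_atTop 1] with k hk
    calc ‖a * e * b‖ = ‖(a * e * b) ^ k‖ := by rw [hgid.pow_eq (by lia)]
      _ = ‖(a * e) ^ k * b ^ k‖ := by rw [haeb.mul_pow]
      _ ≤ ‖(a * e) ^ k‖ * ‖b ^ k‖ := norm_mul_le _ _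
      _ ≤ ‖(a * e) ^ k‖ * ‖b‖ ^ k := by gcongr; exact norm_pow_le' b hk
  have hef : (1 - a * b) * e = e := by rw [sub_mul, ← hg, hg0, sub_zero, one_mul]
  refine ⟨hef ▸ J.mul_mem_right _ _ hJ, n, ?_⟩
  rw [← hef, ← mul_assoc, hn, zero_mul]

lemma RegularMod.dualAdjoint {s : SpectrumKind} {T : X →L[ℂ] X}
    (h : RegularMod (residueIdeal s X) T) :
    RegularMod (residueIdeal s (StrongDual ℂ X)) (dualAdjoint T) := by
  obtain ⟨S, hTS, ⟨n, hn⟩, hJ⟩ := h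
  have h1 : 1 - GInv.dualAdjoint T * GInv.dualAdjoint S = GInv.dualAdjoint (1 - T * S) := by
    rw [hTS.eq, dualAdjoint_sub, dualAdjoint_mul, dualAdjoint_one]
  have hc : Commute (T ^ n) (1 - T * S) := (Commute.one_right _).sub_right
    (((Commute.refl T).mul_right hTS).pow_left n)
  refine ⟨_, Commute.dualAdjoint hTS, ⟨n, ?_⟩, ?_⟩
  · rw [h1, ← dualAdjoint_pow, ← dualAdjoint_mul, ← hc.eq, hn, dualAdjoint_eq_zero_iff.2 rfl]
  · rw [h1]; exact dualAdjoint_mem_residueIdeal_iff.2 hJ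

/-- A Drazin inverse of the adjoint need not be visibly an adjoint, so the idempotent is built on
`X` instead: `0` is at most isolated in `σ(T)`, giving a Riesz idempotent `e` with `T * e`
quasinilpotent. By `RegularMod.idempotent_mem` the adjoint of `e` lies in the ideal and is killed by
a power of the adjoint of `T`; both facts descend to `e`. -/
lemma RegularMod.of_dualAdjoint [CompleteSpace X] {s : SpectrumKind} {T : X →L[ℂ] X}
    (h : RegularMod (residueIdeal s (StrongDual ℂ X)) (GInv.dualAdjoint T)) :
    RegularMod (residueIdeal s X) T := by
  have hiso := h.eventually_notMem_spectrum
  rw [spectrum_dualAdjoint] at hiso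
  rw [eventually_nhdsWithin_iff] at hiso
  obtain ⟨ρ, hρ, hball⟩ := Metric.eventually_nhds_iff.1 hiso
  have hsmall : ∀ z ∈ spectrum ℂ T, ‖z‖ < ρ → z = 0 := fun z hz hzρ => by
    by_contra hz0
    exact hball (by simpa using hzρ) hz0 hz
  obtain ⟨e, he, hTe, hu, hsp⟩ := exists_rieszIdempotent T (half_pos hρ) fun z hz hzr => by
    have h0 := hsmall z hz (by linarith)
    rw [h0, norm_zero] at hzr
    linarith
  have hsp0 : spectrum ℂ (T * e) ⊆ {0} := fun z hz => by
    obtain ⟨h1, h2 | h2⟩ := hsp z hz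
    · exact h2
    · exact hsmall z h2 (by linarith)
  have hTE := Commute.dualAdjoint hTe
  obtain ⟨hEJ, n, hn⟩ := h.idempotent_mem (e := GInv.dualAdjoint e)
    (by rw [← dualAdjoint_mul, he]) hTE fun C hC => by
      refine squeeze_zero (fun k => by positivity) (fun k => ?_)
        (tendsto_norm_pow_mul_of_spectrum_subset hsp0 hC)
      gcongr
      rw [hTE.eq, ← dualAdjoint_mul, ← dualAdjoint_pow]
      exact norm_dualAdjoint_le _
  have heJ : e ∈ residueIdeal s X := dualAdjoint_mem_residueIdeal_iff.1 hEJ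
  have hTne : T ^ n * e = 0 := by
    rw [(hTe.pow_left n).eq, ← dualAdjoint_eq_zero_iff, dualAdjoint_mul, dualAdjoint_pow, hn]
  obtain ⟨W, hW⟩ := hu
  have hTW : Commute T W := by
    rw [hW]
    exact ((Commute.refl T).mul_right ((Commute.one_right T).sub_right hTe)).add_right hTe
  have hT1 : Commute T (1 - e) := (Commute.one_right T).sub_right hTe
  have hf : (1 - e) * (1 - e) = 1 - e := by
    rw [mul_sub, mul_one, sub_mul, he, one_mul, sub_self, sub_zero]
  have hkey : T * (↑W⁻¹ * (1 - e)) = 1 - e := by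
    have : T * (1 - e) = W * (1 - e) := by
      rw [hW, add_mul, mul_assoc, hf, mul_sub e, he, mul_one, sub_self, add_zero]
    rw [← mul_assoc, (hTW.units_inv_right).eq, mul_assoc, this, ← mul_assoc, W.inv_mul, one_mul]
  refine ⟨↑W⁻¹ * (1 - e), hTW.units_inv_right.mul_right hT1, ⟨n, ?_⟩, ?_⟩
  · rw [hkey, sub_sub_cancel, hTne]
  · rwa [hkey, sub_sub_cancel]

lemma sigmaStar_dualAdjoint [CompleteSpace X] (s : SpectrumKind) (T : X →L[ℂ] X) :
    sigmaStar s (GInv.dualAdjoint T) = sigmaStar s T := by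
  ext z
  rw [mem_sigmaStar_iff, mem_sigmaStar_iff, Algebra.algebraMap_eq_smul_one,
    Algebra.algebraMap_eq_smul_one, ← dualAdjoint_smul_one, ← dualAdjoint_sub]
  exact not_congr ⟨RegularMod.of_dualAdjoint, RegularMod.dualAdjoint⟩

end Dual

/-! ### Powers, and the conclusion -/

lemma zero_mem_accIter_sigmaStar_pow_iff {X : Type u} [NormedAddCommGroup X] [NormedSpace ℂ X]
    [CompleteSpace X] (s : SpectrumKind) (α : Ordinal.{w}) (T : X →L[ℂ] X) {m : ℕ} (hm : m ≠ 0) :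
    (0 : ℂ) ∈ accIter (sigmaStar s (T ^ m)) α ↔ (0 : ℂ) ∈ accIter (sigmaStar s T) α := by
  rw [sigmaStar_pow s T hm, accIter_image_pow (isCompact_sigmaStar s T) hm]
  constructor
  · rintro ⟨z, hz, hz0⟩
    rwa [← eq_zero_of_pow_eq_zero hz0]
  · exact fun h => ⟨0, h, zero_pow hm⟩

end GInv

theorem mainTheorem9 {X : Type u} [NormedAddCommGroup X] [NormedSpace ℂ X] [CompleteSpace X]
    (s : GInv.SpectrumKind) (α : Ordinal.{w}) (T : X →L[ℂ] X) :
    (GInv.IsGInvertible s α T ↔ GInv.IsGInvertible s α (GInv.dualAdjoint T)) ∧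
    (∀ {Y : Type v} [NormedAddCommGroup Y] [NormedSpace ℂ Y] [CompleteSpace Y] (S : Y →L[ℂ] Y),
      GInv.IsGInvertible s α (S.prodMap T) ↔
        GInv.IsGInvertible s α S ∧ GInv.IsGInvertible s α T) ∧
    (GInv.IsGInvertible s α T ↔ ∃ m : ℕ, 1 ≤ m ∧ GInv.IsGInvertible s α (T ^ m)) ∧
    (GInv.IsGInvertible s α T ↔ ∀ m : ℕ, 1 ≤ m → GInv.IsGInvertible s α (T ^ m)) := by
  have hpow : ∀ m : ℕ, 1 ≤ m →
      (GInv.IsGInvertible s α (T ^ m) ↔ GInv.IsGInvertible s α T) := fun m hm => by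
    rw [GInv.isGInvertible_iff, GInv.isGInvertible_iff,
      GInv.zero_mem_accIter_sigmaStar_pow_iff s α T (by lia)]
  refine ⟨?_, fun {Y} _ _ _ S => ?_, ⟨fun h => ⟨1, le_rfl, (hpow 1 le_rfl).2 h⟩, ?_⟩,
    fun h m hm => (hpow m hm).2 h, fun h => (hpow 1 le_rfl).1 (h 1 le_rfl)⟩
  · rw [GInv.isGInvertible_iff, GInv.isGInvertible_iff, GInv.sigmaStar_dualAdjoint]
  · rw [GInv.isGInvertible_iff, GInv.isGInvertible_iff, GInv.isGInvertible_iff,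
      GInv.sigmaStar_prodMap, GInv.accIter_union (GInv.isCompact_sigmaStar s S).isClosed
        (GInv.isCompact_sigmaStar s T).isClosed, Set.mem_union, not_or]
  · rintro ⟨m, hm, h⟩
    exact (hpow m hm).1 h
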